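/- **Theorem (Improvement over Davie–Reeds).** Let $n\ge 1$ and let $\gamma$ be the standard Gaussian measure on $\mathbb R^n$. For $k\in\mathbb N$ let $\Pi_k$ be the orthogonal projection of $L^2(\gamma)$ onto $\mathrm{span}\{\mathrm{He}_\alpha : \alpha\in\mathbb N^n,\ \sum_i\alpha_i=k\}$, where $\mathrm{He}_\alpha(x)=\prod_i \mathrm{He}_{\alpha_i}(x_i)$ are the (probabilists') Hermite polynomials, and let $I$ be the identity. For a bounded linear operator $A$ on $L^2(\gamma)$ put $$\mathrm{val}(A)=\sup_{f,g}\ \mathbb E_{X\sim\gamma}\,(Af)(X)\,g(X),$$ the supremum being over all measurable $f,g:\mathbb R^n\to\{\pm1\}$. Let $\phi$ and $\Phi$ be the density and the distribution function of the standard normal distribution on $\mathbb R$, let $C^*\approx 0.25573$ be the unique solution $C\in(0,1)$ of $4\phi(C)^2-4\Phi(-C)+1=0$, and let $\lambda^*=2C^*\phi(C^*)\approx 0.19748$. Define $$A_{DR}=\Pi_1-\lambda^* I,\qquad A_\varepsilon=\Pi_1-\lambda^* I-\varepsilon\,\Pi_3 .$$ Then for every real $\varepsilon\ge 0$, $$\mathrm{val}(A_\varepsilon)\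 \le\ \mathrm{val}(A_{DR})-\varepsilon\left(0.046-12(2\varepsilon)^{1/4}\right).$$ In particular, $\mathrm{val}(A_\varepsilon)<\mathrm{val}(A_{DR})$ whenever $\varepsilon>0$ and $12(2\varepsilon)^{1/4}<0.046$. -/

import Mathlib

noncomputable section

open MeasureTheory ProbabilityTheory

namespace HermiteGame

/-! ### The classical value of a game -/

section Value

variable {Ω : Type*} [MeasurableSpace Ω]

/-- `f : Ω → {±1}`, as a measurable real-valued function. -/
def IsSign (f : Ω → ℝ) : Prop :=
  Measurable f ∧ ∀ x, f x = 1 ∨ f x = -1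

theorem IsSign.norm_eq_one {f : Ω → ℝ} (hf : IsSign f) (x : Ω) : ‖f x‖ = 1 := by
  rcases hf.2 x with h | h <;> simp [h]

theorem IsSign.memLp {f : Ω → ℝ} (hf : IsSign f) (μ : Measure Ω) [IsFiniteMeasure μ] :
    MemLp f 2 μ :=
  MemLp.of_bound hf.1.aestronglyMeasurable 1
    (Filter.Eventually.of_forall fun x => (hf.norm_eq_one x).le)

/-- `val_A(f, g) = ∫ (A f)(X) g(X) dμ(X)`. -/
def valAt {μ : Measure Ω} (A : Lp ℝ 2 μ →L[ℝ] Lp ℝ 2 μ) (f g : Lp ℝ 2 μ) : ℝ :=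
  ∫ x, (A f) x * g x ∂μ

/-- The values `val_A(f, g)` for all `f, g : Ω → {±1}`. -/
def valSet {μ : Measure Ω} [IsFiniteMeasure μ] (A : Lp ℝ 2 μ →L[ℝ] Lp ℝ 2 μ) : Set ℝ :=
  {v | ∃ (f g : Ω → ℝ) (hf : IsSign f) (hg : IsSign g),
    v = valAt A ((hf.memLp μ).toLp f) ((hg.memLp μ).toLp g)}

/-- `val(A)`, the supremum of `val_A(f, g)` over all `f, g : Ω → {±1}`. -/
def val {μ : Measure Ω} [IsFiniteMeasure μ] (A : Lp ℝ 2 μ →L[ℝ] Lp ℝ 2 μ) : ℝ :=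
  sSup (valSet A)

theorem valSet_nonempty {μ : Measure Ω} [IsFiniteMeasure μ] (A : Lp ℝ 2 μ →L[ℝ] Lp ℝ 2 μ) :
    (valSet A).Nonempty :=
  have h : IsSign (fun _ : Ω => (1 : ℝ)) := ⟨measurable_const, fun _ => Or.inl rfl⟩
  ⟨_, _, _, h, h, rfl⟩

theorem valAt_eq_inner {μ : Measure Ω} (A : Lp ℝ 2 μ →L[ℝ] Lp ℝ 2 μ) (f g : Lp ℝ 2 μ) :
    valAt A f g = inner ℝ (A f) g := by
  rw [L2.inner_def, valAt]
  congr 1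
  ext x
  simp [mul_comm]

/-- The supremum in `val` is that of a set of reals that is bounded above. -/
theorem valSet_bddAbove {μ : Measure Ω} [IsFiniteMeasure μ] (A : Lp ℝ 2 μ →L[ℝ] Lp ℝ 2 μ) :
    BddAbove (valSet A) := by
  have key : ∀ (f : Ω → ℝ) (hf : IsSign f),
      ‖(hf.memLp μ).toLp f‖ ≤ μ.real Set.univ ^ ((2 : ENNReal).toReal)⁻¹ * 1 := by
    intro f hf
    refine Lp.norm_le_of_ae_bound zero_le_one ?_
    filter_upwards [(hf.memLp μ).coeFn_toLp] with x hx
    rw [hx, hf.norm_eq_one]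
  refine ⟨‖A‖ * (μ.real Set.univ ^ ((2 : ENNReal).toReal)⁻¹ * 1) *
    (μ.real Set.univ ^ ((2 : ENNReal).toReal)⁻¹ * 1), ?_⟩
  rintro v ⟨f, g, hf, hg, rfl⟩
  rw [valAt_eq_inner]
  refine (real_inner_le_norm _ _).trans ?_
  refine mul_le_mul ((A.le_opNorm _).trans ?_) (key g hg) (norm_nonneg _) (by positivity)
  exact mul_le_mul_of_nonneg_left (key f hf) (norm_nonneg _)

end Value

/-! ### Hermite polynomials and Hermite projections on Gaussian space -/

/-- The `n`-dimensional standard Gaussian measure. -/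
abbrev γ (n : ℕ) : Measure (EuclideanSpace ℝ (Fin n)) :=
  stdGaussian (EuclideanSpace ℝ (Fin n))

/-- The multivariate Hermite polynomial `He_α(x) = ∏ i, He_{α i}(x i)`
(probabilists' convention). -/
def hermiteFun {n : ℕ} (α : Fin n → ℕ) (x : EuclideanSpace ℝ (Fin n)) : ℝ :=
  ∏ i, Polynomial.aeval (x i) (Polynomial.hermite (α i))

theorem memLp_mul {Ω : Type*} [MeasurableSpace Ω] {μ : Measure Ω} {f g : Ω → ℝ}
    (hf : ∀ p : ENNReal, p ≠ ⊤ → MemLp f p μ) (hg : ∀ p : ENNReal, p ≠ ⊤ → MemLp g p μ) :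
    ∀ p : ENNReal, p ≠ ⊤ → MemLp (fun x => f x * g x) p μ := by
  intro p hp
  have h2 : (2 * p) ≠ ⊤ := ENNReal.mul_ne_top (by norm_num) hp
  have : ENNReal.HolderTriple (2 * p) (2 * p) p := by
    constructor
    rw [ENNReal.mul_inv (Or.inl (by norm_num)) (Or.inl (by norm_num)), ← add_mul,
      ENNReal.inv_two_add_inv_two, one_mul]
  exact MemLp.mul' (hg (2 * p) h2) (hf (2 * p) h2)

theorem memLp_coord {n : ℕ} (i : Fin n) (p : ENNReal) (hp : p ≠ ⊤) :
    MemLp (fun x : EuclideanSpace ℝ (Fin n) => x i) p (γ n) :=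
  (IsGaussian.memLp_id (γ n) p hp).continuousLinearMap_comp
    (EuclideanSpace.proj i : EuclideanSpace ℝ (Fin n) →L[ℝ] ℝ)

theorem memLp_poly {n : ℕ} (i : Fin n) (q : Polynomial ℤ) (p : ENNReal) (hp : p ≠ ⊤) :
    MemLp (fun x : EuclideanSpace ℝ (Fin n) => Polynomial.aeval (x i) q) p (γ n) := by
  induction q using Polynomial.induction_on' generalizing p with
  | add q r hq hr =>
    simp only [map_add]
    exact (hq p hp).add (hr p hp)
  | monomial k a =>
    simp only [Polynomial.aeval_monomial]
    refine memLp_mul (fun p _ => memLp_const _) (fun p hp => ?_) p hp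
    induction k generalizing p with
    | zero => simpa only [pow_zero] using memLp_const _
    | succ k ih => simpa only [pow_succ] using memLp_mul ih (memLp_coord i) p hp

theorem memLp_hermiteFun {n : ℕ} (α : Fin n → ℕ) : MemLp (hermiteFun α) 2 (γ n) := by
  have : ∀ (s : Finset (Fin n)) (p : ENNReal), p ≠ ⊤ →
      MemLp (fun x : EuclideanSpace ℝ (Fin n) =>
        ∏ i ∈ s, Polynomial.aeval (x i) (Polynomial.hermite (α i))) p (γ n) := by
    intro s
    induction s using Finset.induction_on with
    | empty => intro p _; simpa only [Finset.prod_empty] using memLp_const _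
    | insert a s ha ih =>
      simpa only [Finset.prod_insert ha] using memLp_mul (memLp_poly a _) ih
  exact this Finset.univ 2 (by norm_num)

/-- `He_α` as an element of `L²(γ)`. -/
def hermiteLp {n : ℕ} (α : Fin n → ℕ) : Lp ℝ 2 (γ n) :=
  (memLp_hermiteFun α).toLp (hermiteFun α)

/-- `span {He_α : |α| = k}`, where `|α| = ∑ i, α i`. -/
def hermiteSpace (n k : ℕ) : Submodule ℝ (Lp ℝ 2 (γ n)) :=
  Submodule.span ℝ (hermiteLp '' {α : Fin n → ℕ | ∑ i, α i = k})

instance finiteDimensional_hermiteSpace (n k : ℕ) : FiniteDimensional ℝ (hermiteSpace n k) := by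
  have h : {α : Fin n → ℕ | ∑ i, α i = k}.Finite :=
    (Finset.finite_toSet (Finset.piAntidiag Finset.univ k)).subset fun α hα => by
      simpa using hα
  exact FiniteDimensional.span_of_finite ℝ (h.image _)

/-- `Π_k`, the orthogonal projection of `L²(γ)` onto the degree-`k` Hermite polynomials. -/
def hermiteProj (n k : ℕ) : Lp ℝ 2 (γ n) →L[ℝ] Lp ℝ 2 (γ n) :=
  (hermiteSpace n k).starProjection

/-! ### The constants `C*` and `λ*` -/

/-- The standard normal density `φ`. -/
def phi (x : ℝ) : ℝ := 1 / Real.sqrt (2 * Real.pi) * Real.exp (-x ^ 2 / 2)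

/-- The standard normal distribution function `Φ`. -/
def Phi (x : ℝ) : ℝ := ∫ t in Set.Iic x, phi t

theorem phi_eq_gaussianPDFReal : phi = gaussianPDFReal 0 1 := by
  ext x
  simp [phi, gaussianPDFReal]

theorem continuous_phi : Continuous phi := by
  unfold phi
  fun_prop

theorem integrable_phi : Integrable phi := by
  rw [phi_eq_gaussianPDFReal]
  exact integrable_gaussianPDFReal 0 1

theorem phi_pos (x : ℝ) : 0 < phi x := by
  unfold phi
  positivity

theorem phi_neg (x : ℝ) : phi (-x) = phi x := by
  simp [phi]

theorem Phi_zero : Phi 0 = 1 / 2 := by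
  have h1 : ∫ t, phi t = 1 := by
    rw [phi_eq_gaussianPDFReal]
    exact integral_gaussianPDFReal_eq_one 0 one_ne_zero
  have h2 : ∫ t in Set.Ioi (0 : ℝ), phi t = Phi 0 := by
    have := integral_comp_neg_Iic (0 : ℝ) phi
    simp only [phi_neg, neg_zero] at this
    exact this.symm
  have h3 := intervalIntegral.integral_Iic_add_Ioi (b := (0 : ℝ)) (f := phi)
    integrable_phi.integrableOn integrable_phi.integrableOn
  rw [h2, h1] at h3
  change Phi 0 + Phi 0 = 1 at h3
  linarith

theorem hasDerivAt_Phi (x : ℝ) : HasDerivAt Phi (phi x) x := by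
  have h : Phi = fun y => Phi 0 + ∫ t in (0 : ℝ)..y, phi t := by
    ext y
    have := intervalIntegral.integral_Iic_sub_Iic (a := 0) (b := y) (f := phi) (μ := volume)
      integrable_phi.integrableOn integrable_phi.integrableOn
    rw [← this]
    simp [Phi]
  rw [h]
  exact (intervalIntegral.integral_hasDerivAt_right
    (continuous_phi.intervalIntegrable _ _)
    (continuous_phi.stronglyMeasurableAtFilter _ _) continuous_phi.continuousAt).const_add _

theorem hasDerivAt_phi (x : ℝ) : HasDerivAt phi (-x * phi x) x := by
  have h1 : HasDerivAt (fun y : ℝ => -y ^ 2 / 2) (-x) x := by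
    refine (((hasDerivAt_pow 2 x).neg).div_const 2).congr_deriv ?_
    norm_num
    ring
  refine (h1.exp.const_mul (1 / Real.sqrt (2 * Real.pi))).congr_deriv ?_
  unfold phi
  ring

theorem phi_sq (x : ℝ) : phi x ^ 2 = 1 / (2 * Real.pi) * Real.exp (-x ^ 2) := by
  unfold phi
  rw [mul_pow, div_pow, Real.sq_sqrt (by positivity), ← Real.exp_nat_mul]
  norm_num
  ring

theorem phi_lt_half (x : ℝ) : phi x < 1 / 2 := by
  have h1 : phi x ^ 2 ≤ 1 / (2 * Real.pi) := by
    rw [phi_sq]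
    refine mul_le_of_le_one_right (by positivity) (Real.exp_le_one_iff.2 ?_)
    nlinarith [sq_nonneg x]
  have h2 : 1 / (2 * Real.pi) < 1 / 4 := by
    apply one_div_lt_one_div_of_lt <;> linarith [Real.pi_gt_three]
  nlinarith [phi_pos x]

/-- The function of `C` whose root in `(0, 1)` is `C*`. -/
def rootFun (C : ℝ) : ℝ := 4 * phi C ^ 2 - 4 * Phi (-C) + 1

theorem hasDerivAt_rootFun (x : ℝ) :
    HasDerivAt rootFun (4 * phi x * (1 - 2 * x * phi x)) x := by
  have h1 := ((hasDerivAt_phi x).pow 2).const_mul 4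
  have h2 : HasDerivAt (fun y => Phi (-y)) (phi (-x) * (-1)) x :=
    (hasDerivAt_Phi (-x)).comp x (hasDerivAt_neg x)
  refine ((h1.sub (h2.const_mul 4)).add_const 1).congr_deriv ?_
  rw [phi_neg]
  push_cast
  ring

/-- `4 φ(C)² - 4 Φ(-C) + 1 = 0` has exactly one solution `C ∈ (0, 1)`. -/
theorem existsUnique_root : ∃! C : ℝ, C ∈ Set.Ioo (0 : ℝ) 1 ∧
    4 * phi C ^ 2 - 4 * Phi (-C) + 1 = 0 := by
  have hcont : Continuous rootFun :=
    continuous_iff_continuousAt.2 fun x => (hasDerivAt_rootFun x).continuousAt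
  have hmono : StrictMonoOn rootFun (Set.Icc 0 1) := by
    refine strictMonoOn_of_deriv_pos (convex_Icc 0 1) hcont.continuousOn fun x hx => ?_
    rw [interior_Icc] at hx
    rw [(hasDerivAt_rootFun x).deriv]
    have h1 := phi_lt_half x
    have h2 := phi_pos x
    have h3 : 0 < 1 - 2 * x * phi x := by nlinarith [hx.1, hx.2]
    positivity
  have hPhi1 : Phi (-1) ≤ 1 / 2 - phi 1 := by
    have h := intervalIntegral.integral_Iic_sub_Iic (a := -1) (b := 0) (f := phi) (μ := volume)
      integrable_phi.integrableOn integrable_phi.integrableOn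
    have h' : (∫ t in (-1 : ℝ)..0, phi 1) ≤ ∫ t in (-1 : ℝ)..0, phi t := by
      refine intervalIntegral.integral_mono_on (by norm_num) (by simp)
        (continuous_phi.intervalIntegrable _ _) fun t ht => ?_
      unfold phi
      refine mul_le_mul_of_nonneg_left (Real.exp_le_exp.2 ?_) (by positivity)
      nlinarith [ht.1, ht.2]
    rw [← h] at h'
    change _ ≤ Phi 0 - Phi (-1) at h'
    rw [Phi_zero] at h'
    simp at h'
    linarith
  have h0 : rootFun 0 < 0 := by
    have h1 := phi_lt_half 0
    have h2 := phi_pos 0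
    simp only [rootFun, neg_zero, Phi_zero]
    nlinarith
  have h1 : 0 < rootFun 1 := by
    have h2 := phi_pos 1
    have h3 := phi_sq 1
    have he : Real.exp (-1) > 1 / 3 := by
      rw [Real.exp_neg, gt_iff_lt, one_div]
      exact inv_strictAnti₀ (Real.exp_pos 1) (by linarith [Real.exp_one_lt_d9])
    have hpi : 1 / (2 * Real.pi) > 10 / 63 := by
      rw [gt_iff_lt, div_lt_div_iff₀ (by norm_num) (by positivity)]
      linarith [Real.pi_lt_d2]
    have h4 : phi 1 ^ 2 > 1 / 19 := by
      rw [h3, one_pow]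
      calc (1 / 19 : ℝ) < 10 / 63 * (1 / 3) := by norm_num
        _ < _ := mul_lt_mul'' hpi he (by norm_num) (by norm_num)
    have h5 : phi 1 > 11 / 50 := by nlinarith
    unfold rootFun
    nlinarith
  obtain ⟨c, hc, hc0⟩ := intermediate_value_Ioo (zero_le_one' ℝ) hcont.continuousOn ⟨h0, h1⟩
  refine ⟨c, ⟨hc, hc0⟩, fun d hd => ?_⟩
  exact hmono.injOn (Set.Ioo_subset_Icc_self hd.1) (Set.Ioo_subset_Icc_self hc)
    (hd.2.trans hc0.symm)

/-- `C* ≈ 0.25573`, the unique solution `C ∈ (0, 1)` of `4 φ(C)² - 4 Φ(-C) + 1 = 0`. -/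
def Cstar : ℝ := existsUnique_root.choose

/-- `λ* = 2 C* φ(C*) ≈ 0.19748`. -/
def lamStar : ℝ := 2 * Cstar * phi Cstar

/-! ### The Davie–Reeds game and its perturbation -/

/-- The perturbed Davie–Reeds game `A_{ε,λ} = Π_1 - λ I - ε Π_3` on `L²(γ)`. -/
def perturbedGame (n : ℕ) (ε lam : ℝ) : Lp ℝ 2 (γ n) →L[ℝ] Lp ℝ 2 (γ n) :=
  hermiteProj n 1 - lam • ContinuousLinearMap.id ℝ (Lp ℝ 2 (γ n)) - ε • hermiteProj n 3

/-- `A_ε = Π_1 - λ* I - ε Π_3`. -/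
def gameA (n : ℕ) (ε : ℝ) : Lp ℝ 2 (γ n) →L[ℝ] Lp ℝ 2 (γ n) :=
  perturbedGame n ε lamStar

/-- The Davie–Reeds game `A_DR = Π_1 - λ* I`. -/
def gameDR (n : ℕ) : Lp ℝ 2 (γ n) →L[ℝ] Lp ℝ 2 (γ n) :=
  hermiteProj n 1 - lamStar • ContinuousLinearMap.id ℝ (Lp ℝ 2 (γ n))

end HermiteGame

end

noncomputable section

open MeasureTheory ProbabilityTheory

namespace HermiteGame

/-! Put F = (f + g)/2 and D = (f - g)/2. They take values in {-1, 0, 1}, have complementary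
supports, and self-adjointness of a projection gives ⟨Π_k f, g⟩ = ‖Π_k F‖² - ‖Π_k D‖². Write A =
`Astar`, C = `Cstar`, λ = `lamStar` = C·A. An explicit pair shows val(A_DR) ≥ A²(1 - λ)
(`le_val_gameDR`); the reverse inequality is never needed. If the Davie–Reeds value of (f, g) is at
most A²(1 - λ) - 2ε, then |⟨Π_3 f, g⟩| ≤ 1 already suffices. Otherwise the pair is nearly optimal,
and with δ = 2ε the point is that ⟨Π_3 f, g⟩ ≥ 0.046 - 12 δ^(1/4) (`inner_hermiteProj_three_ge`).

Stability. There is a unit vector u such that h = ⟨u, x⟩ satisfies ‖Π_1 F‖ = E[F h] =: a, and the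
Davie–Reeds value is at most a² + λ - 2λ E[F²]. The deficit of this quantity from A²(1 - λ) is
exactly 2 E[loss] - (a - A)², where `loss` is the pointwise gap in maximising A y h - λ y² over y in
{-1, 0, 1}. The square is absorbed by `sq_sub_le_integral_loss`, so E[loss] = O(δ), and F is within
5√δ in L¹ of the maximiser `optSign h`, the sign of h cut to zero on the slab |h| ≤ C
(`integral_dist_le`).

Degree three. The ideal F has inner product -A(1 - C²) with He_3(h), whose norm is √6, so ‖Π_3 F‖²
is at least about A²(1 - C²)²/6. The ideal D lives on the slab, of mass p = (1 - A²)/2. A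
degree-three Hermite element P has at most the fraction p of its squared norm on the slab
(`integral_slab_inner_sq_le`), so Cauchy–Schwarz bounds ‖Π_3 D‖ by about p. The two bounds differ by
at least 0.046 (`degree_three_gap`). -/

/-- The standard Gaussian measure on the real line. -/
abbrev γ₁ : Measure ℝ := gaussianReal 0 1

/-! ### One-variable Gaussian integrals and Hermite polynomials -/

theorem integral_γ₁ (f : ℝ → ℝ) : ∫ x, f x ∂γ₁ = ∫ x, phi x * f x := by
  rw [integral_gaussianReal_eq_integral_smul one_ne_zero, ← phi_eq_gaussianPDFReal]
  rfl

theorem integrable_γ₁_iff (f : ℝ → ℝ) : Integrable f γ₁ ↔ Integrable (fun x => phi x * f x) := by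
  rw [γ₁, gaussianReal_of_var_ne_zero _ one_ne_zero,
    integrable_withDensity_iff_integrable_smul' (measurable_gaussianPDF _ _)
      (Filter.Eventually.of_forall fun x => gaussianPDF_lt_top)]
  simp only [toReal_gaussianPDF, ← phi_eq_gaussianPDFReal, smul_eq_mul]

theorem memLp_eval_γ₁ (q : Polynomial ℝ) (p : ENNReal) (hp : p ≠ ⊤) :
    MemLp (fun x => q.eval x) p γ₁ := by
  induction q using Polynomial.induction_on' generalizing p with
  | add q r hq hr =>
    simp only [Polynomial.eval_add]
    exact (hq p hp).add (hr p hp)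
  | monomial k a =>
    simp only [Polynomial.eval_monomial]
    refine memLp_mul (fun p _ => memLp_const _) (fun p hp => ?_) p hp
    induction k generalizing p with
    | zero => simpa only [pow_zero] using memLp_const _
    | succ k ih =>
      simpa only [pow_succ, id] using memLp_mul ih (fun p hp => IsGaussian.memLp_id γ₁ p hp) p hp

theorem integrable_eval_γ₁ (q : Polynomial ℝ) : Integrable (fun x => q.eval x) γ₁ :=
  memLp_one_iff_integrable.1 (memLp_eval_γ₁ q 1 (by norm_num))

/-- Gaussian integration by parts for polynomials. -/
theorem integral_mul_eval_γ₁ (q : Polynomial ℝ) :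
    ∫ x, x * q.eval x ∂γ₁ = ∫ x, q.derivative.eval x ∂γ₁ := by
  have h1 : Integrable (fun x => q.derivative.eval x) γ₁ := integrable_eval_γ₁ _
  have h2 : Integrable (fun x => x * q.eval x) γ₁ := 
    (integrable_eval_γ₁ (Polynomial.X * q)).congr (.of_forall fun x => by simp)
  have h3 : Integrable (fun x => q.eval x) γ₁ := integrable_eval_γ₁ _
  rw [eq_comm, ← sub_eq_zero, ← integral_sub h1 h2, integral_γ₁]
  refine integral_eq_zero_of_hasDerivAt_of_integrable (f := fun x => phi x * q.eval x)
    (fun x => ?_) ((integrable_γ₁_iff _).1 (h1.sub h2)) ((integrable_γ₁_iff _).1 h3)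
  refine ((hasDerivAt_phi x).mul (q.hasDerivAt x)).congr_deriv ?_
  ring

/-- The Hermite polynomials with real coefficients. -/
def hermiteReal (k : ℕ) : Polynomial ℝ := (Polynomial.hermite k).map (Int.castRingHom ℝ)

theorem aeval_hermite (k : ℕ) (x : ℝ) :
    Polynomial.aeval x (Polynomial.hermite k) = (hermiteReal k).eval x := by
  rw [hermiteReal, Polynomial.eval_map, Polynomial.aeval_def]
  rfl

theorem hermiteReal_zero : hermiteReal 0 = 1 := by simp [hermiteReal]

theorem hermiteReal_succ (k : ℕ) : hermiteReal (k + 1) =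
    Polynomial.X * hermiteReal k - Polynomial.derivative (hermiteReal k) := by
  simp [hermiteReal, Polynomial.hermite_succ, Polynomial.derivative_map]

theorem derivative_hermiteReal_succ (k : ℕ) :
    Polynomial.derivative (hermiteReal (k + 1)) = ((k : ℝ) + 1) • hermiteReal k := by
  induction k with
  | zero => simp [hermiteReal_succ, hermiteReal_zero]
  | succ k ih =>
    rw [hermiteReal_succ (k + 1), map_sub, Polynomial.derivative_mul, ih, Polynomial.derivative_X,
      Polynomial.derivative_smul]
    have h := hermiteReal_succ k
    have h' : Polynomial.derivative (hermiteReal k) =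
        Polynomial.X * hermiteReal k - hermiteReal (k + 1) := by rw [h]; ring
    rw [h', one_mul, mul_smul_comm, smul_sub]
    push_cast
    module

theorem hermiteReal_two_step (k : ℕ) : Polynomial.X * hermiteReal (k + 1) =
    hermiteReal (k + 2) + ((k : ℝ) + 1) • hermiteReal k := by
  rw [hermiteReal_succ (k + 1), derivative_hermiteReal_succ]
  ring

/-- Since He_{k+1} = x He_k - He_k', integrating x He_k q by parts cancels the He_k' q term:
multiplying up the Hermite ladder is adjoint to differentiation. Iterating this gives orthogonality.
-/
theorem integral_hermite_succ_mul (k : ℕ) (q : Polynomial ℝ) :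
    ∫ x, (hermiteReal (k + 1)).eval x * q.eval x ∂γ₁ =
      ∫ x, (hermiteReal k).eval x * q.derivative.eval x ∂γ₁ := by
  have h := integral_mul_eval_γ₁ (hermiteReal k * q)
  have h1 : Integrable (fun x => (hermiteReal k).derivative.eval x * q.eval x) γ₁ := by
    simpa using integrable_eval_γ₁ ((hermiteReal k).derivative * q)
  have h2 : Integrable (fun x => (hermiteReal k).eval x * q.derivative.eval x) γ₁ := by
    simpa using integrable_eval_γ₁ (hermiteReal k * q.derivative)
  have h3 : Integrable (fun x => x * ((hermiteReal k).eval x * q.eval x)) γ₁ := 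
    (integrable_eval_γ₁ (Polynomial.X * (hermiteReal k * q))).congr (.of_forall fun x => by simp)
  simp only [Polynomial.derivative_mul, Polynomial.eval_add, Polynomial.eval_mul] at h
  rw [integral_add h1 h2] at h
  rw [← add_right_inj (∫ x, (hermiteReal k).derivative.eval x * q.eval x ∂γ₁), ← h]
  rw [← eq_sub_iff_add_eq', ← integral_sub h3 h1]
  refine integral_congr_ae (Filter.Eventually.of_forall fun x => ?_)
  simp [hermiteReal_succ]
  ring

theorem integral_hermite_mul_hermite (k l : ℕ) :
    ∫ x, (hermiteReal k).eval x * (hermiteReal l).eval x ∂γ₁ =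
      if k = l then (k.factorial : ℝ) else 0 := by
  induction k generalizing l with
  | zero =>
    cases l with
    | zero => simp [hermiteReal_zero]
    | succ l =>
      simp_rw [mul_comm (Polynomial.eval _ (hermiteReal 0))]
      rw [integral_hermite_succ_mul]
      simp [hermiteReal_zero]
  | succ k ih =>
    rw [integral_hermite_succ_mul]
    cases l with
    | zero => simp [hermiteReal_zero]
    | succ l =>
      simp only [derivative_hermiteReal_succ, Polynomial.eval_smul, smul_eq_mul,
        mul_left_comm _ ((l : ℝ) + 1)]
      rw [integral_const_mul, ih]
      by_cases h : k = l
      · subst h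
        simp [Nat.factorial_succ]
      · simp [h]

theorem hermiteReal_one_eval (x : ℝ) : (hermiteReal 1).eval x = x := by
  simp [hermiteReal_succ, hermiteReal_zero]

theorem hermiteReal_two_eval (x : ℝ) : (hermiteReal 2).eval x = x ^ 2 - 1 := by
  simp [hermiteReal_succ, hermiteReal_zero]
  ring

theorem hermiteReal_three_eval (x : ℝ) : (hermiteReal 3).eval x = x ^ 3 - 3 * x := by
  simp [hermiteReal_succ, hermiteReal_zero]
  ring

/-! ### Hermite functions on Gaussian space -/

variable {n : ℕ}

theorem integral_prod_γ (f : Fin n → ℝ → ℝ) :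
    ∫ x, ∏ i, f i (x i) ∂(γ n) = ∏ i, ∫ t, f i t ∂γ₁ := by
  rw [← integral_fintype_prod_eq_prod (μ := fun _ : Fin n => γ₁) f, γ, ← map_pi_eq_stdGaussian]
  exact (MeasurableEquiv.toLp 2 (Fin n → ℝ)).measurableEmbedding.integral_map _

theorem hermiteFun_eq (α : Fin n → ℕ) (x : EuclideanSpace ℝ (Fin n)) :
    hermiteFun α x = ∏ i, (hermiteReal (α i)).eval (x i) := by
  simp only [hermiteFun, aeval_hermite]

theorem integral_hermiteFun_mul_of_ne {α β : Fin n → ℕ} (h : α ≠ β) :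
    ∫ x, hermiteFun α x * hermiteFun β x ∂(γ n) = 0 := by
  simp only [hermiteFun_eq, ← Finset.prod_mul_distrib]
  rw [integral_prod_γ fun i t => (hermiteReal (α i)).eval t * (hermiteReal (β i)).eval t]
  obtain ⟨i, hi⟩ := Function.ne_iff.1 h
  exact Finset.prod_eq_zero (Finset.mem_univ i) (by rw [integral_hermite_mul_hermite, if_neg hi])

theorem integral_weight_hermiteFun_mul (w : ℝ → ℝ) (j : Fin n) (α β : Fin n → ℕ) :
    ∫ x, w (x j) * (hermiteFun α x * hermiteFun β x) ∂(γ n) =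
      (∫ t, w t * ((hermiteReal (α j)).eval t * (hermiteReal (β j)).eval t) ∂γ₁) *
        ∏ i ∈ Finset.univ.erase j, (if α i = β i then ((α i).factorial : ℝ) else 0) := by
  have h := integral_prod_γ fun i t => (if i = j then w t else 1) *
    ((hermiteReal (α i)).eval t * (hermiteReal (β i)).eval t)
  rw [← Finset.mul_prod_erase _ _ (Finset.mem_univ j)] at h
  simp only [if_true] at h
  convert h using 2
  · ext x
    rw [Finset.prod_mul_distrib, Finset.prod_mul_distrib, Finset.prod_ite_eq' Finset.univ j,
      hermiteFun_eq, hermiteFun_eq]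
    simp
  · refine Finset.prod_congr rfl fun i hi => ?_
    simp [(Finset.mem_erase.1 hi).1, integral_hermite_mul_hermite]

/-- With equal totals, indices that agree off `j` also agree at `j`; so distinct ones differ at
another coordinate, whose unweighted factor vanishes by orthogonality. -/
theorem integral_weight_hermiteFun_mul_of_ne (w : ℝ → ℝ) (j : Fin n) {α β : Fin n → ℕ}
    (hs : ∑ i, α i = ∑ i, β i) (h : α ≠ β) :
    ∫ x, w (x j) * (hermiteFun α x * hermiteFun β x) ∂(γ n) = 0 := by
  rw [integral_weight_hermiteFun_mul]
  refine mul_eq_zero_of_right _ ?_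
  have : ∃ i, i ≠ j ∧ α i ≠ β i := by
    by_contra! hc
    apply h
    ext i
    by_cases hi : i = j
    · rw [← Finset.add_sum_erase _ _ (Finset.mem_univ j),
        ← Finset.add_sum_erase _ β (Finset.mem_univ j),
        Finset.sum_congr rfl fun i hi => hc i (Finset.mem_erase.1 hi).1] at hs
      rw [hi]
      exact Nat.add_right_cancel hs
    · exact hc i hi
  obtain ⟨i, hij, hi⟩ := this
  exact Finset.prod_eq_zero (Finset.mem_erase.2 ⟨hij, Finset.mem_univ i⟩) (if_neg hi)

theorem integral_hermiteFun_sq (α : Fin n → ℕ) :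
    ∫ x, hermiteFun α x * hermiteFun α x ∂(γ n) = ∏ i, ((α i).factorial : ℝ) := by
  simp only [hermiteFun_eq, ← Finset.prod_mul_distrib]
  rw [integral_prod_γ fun i t => (hermiteReal (α i)).eval t * (hermiteReal (α i)).eval t]
  simp [integral_hermite_mul_hermite]

theorem map_inner_γ {u : EuclideanSpace ℝ (Fin n)} (hu : ‖u‖ = 1) :
    (γ n).map (fun x => inner ℝ u x) = γ₁ := by
  have h := IsGaussian.map_eq_gaussianReal (μ := γ n) (innerSL ℝ u)
  have e : (⇑(innerSL ℝ u) : EuclideanSpace ℝ (Fin n) → ℝ) = fun x => inner ℝ u x := rfl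
  rw [variance_dual_stdGaussian, integral_strongDual_stdGaussian, innerSL_apply_norm, hu] at h
  simpa [e] using h

-- Hermite spans under multiplication by coordinates and rotation

local notation "𝔼" n => EuclideanSpace ℝ (Fin n)

/-- The span of the functions `He_α`, `α ∈ S`. -/
def hermiteFunSpan (S : Set (Fin n → ℕ)) : Submodule ℝ ((𝔼 n) → ℝ) :=
  Submodule.span ℝ (hermiteFun '' S)

theorem hermiteFun_mem_span {S : Set (Fin n → ℕ)} {α : Fin n → ℕ} (h : α ∈ S) :
    hermiteFun α ∈ hermiteFunSpan S :=
  Submodule.subset_span ⟨α, h, rfl⟩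

theorem hermiteFunSpan_mono {P Q : (Fin n → ℕ) → Prop} (h : ∀ α, P α → Q α) :
    hermiteFunSpan {α | P α} ≤ hermiteFunSpan {α | Q α} :=
  Submodule.span_mono (Set.image_mono fun α => by simpa using h α)

/-- For `k = 0` the truncated index `k - 1` does no harm, as its coefficient is zero. -/
theorem hermiteReal_mul_X (k : ℕ) (t : ℝ) : t * (hermiteReal k).eval t =
    (hermiteReal (k + 1)).eval t + k * (hermiteReal (k - 1)).eval t := by
  cases k with
  | zero => simp [hermiteReal_zero, hermiteReal_one_eval]
  | succ k =>
    have h := congrArg (Polynomial.eval t) (hermiteReal_two_step k)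
    simpa using h

theorem hermiteFun_update (α : Fin n → ℕ) (j : Fin n) (k : ℕ) (x : 𝔼 n) :
    hermiteFun (Function.update α j k) x = (hermiteReal k).eval (x j) *
      ∏ i ∈ Finset.univ.erase j, (hermiteReal (α i)).eval (x i) := by
  rw [hermiteFun_eq, ← Finset.mul_prod_erase _ _ (Finset.mem_univ j), Function.update_self]
  congr 1
  refine Finset.prod_congr rfl fun i hi => ?_
  rw [Function.update_of_ne (Finset.mem_erase.1 hi).1]

theorem coord_mul_hermiteFun_update (α : Fin n → ℕ) (j : Fin n) (k : ℕ) (x : 𝔼 n) :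
    x j * hermiteFun (Function.update α j k) x = hermiteFun (Function.update α j (k + 1)) x +
      k * hermiteFun (Function.update α j (k - 1)) x := by
  simp only [hermiteFun_update]
  rw [← mul_assoc, hermiteReal_mul_X]
  ring

theorem sum_update (α : Fin n → ℕ) (j : Fin n) (k : ℕ) :
    ∑ i, Function.update α j k i + α j = ∑ i, α i + k := by
  rw [Finset.sum_update_of_mem (Finset.mem_univ j),
    ← Finset.add_sum_erase _ _ (Finset.mem_univ j), Finset.sdiff_singleton_eq_erase]
  ring

theorem coord_mul_mem_hermiteFunSpan {d : ℕ} {p : (𝔼 n) → ℝ}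
    (hp : p ∈ hermiteFunSpan {α : Fin n → ℕ | ∑ i, α i ≤ d}) (j : Fin n) :
    (fun x => x j * p x) ∈ hermiteFunSpan {α : Fin n → ℕ | ∑ i, α i ≤ d + 1} := by
  induction hp using Submodule.span_induction with
  | mem p hp =>
    obtain ⟨α, hα, rfl⟩ := hp
    have h : (fun x : 𝔼 n => x j * hermiteFun α x) =
        hermiteFun (Function.update α j (α j + 1)) +
          (α j : ℝ) • hermiteFun (Function.update α j (α j - 1)) := by
      ext x
      simpa using coord_mul_hermiteFun_update α j (α j) x
    rw [h]
    have h1 := sum_update α j (α j + 1)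
    have h2 := sum_update α j (α j - 1)
    simp only [Set.mem_ofPred_eq] at hα
    refine add_mem (hermiteFun_mem_span ?_) (Submodule.smul_mem _ _ (hermiteFun_mem_span ?_)) <;>
      simp only [Set.mem_ofPred_eq] <;> omega
  | zero =>
    convert Submodule.zero_mem _ using 1
    ext x
    simp
  | add p q _ _ hp hq =>
    convert add_mem hp hq using 1
    ext x
    simp [mul_add]
  | smul a p _ hp =>
    convert Submodule.smul_mem _ a hp using 1
    ext x
    simp [mul_left_comm]

theorem inner_mul_mem_hermiteFunSpan {d : ℕ} {p : (𝔼 n) → ℝ}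
    (hp : p ∈ hermiteFunSpan {α : Fin n → ℕ | ∑ i, α i ≤ d}) (v : 𝔼 n) :
    (fun x => inner ℝ v x * p x) ∈ hermiteFunSpan {α : Fin n → ℕ | ∑ i, α i ≤ d + 1} := by
  have h : (fun x => inner ℝ v x * p x) = ∑ j, v j • (fun x : 𝔼 n => x j * p x) := by
    ext x
    simp only [PiLp.inner_apply, Finset.sum_mul, Finset.sum_apply, Pi.smul_apply, smul_eq_mul]
    refine Finset.sum_congr rfl fun j _ => ?_
    simp [mul_comm, mul_left_comm]
  rw [h]
  exact Submodule.sum_mem _ fun j _ =>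
    Submodule.smul_mem _ _ (coord_mul_mem_hermiteFunSpan hp j)

theorem isometry_apply_coord (R : (𝔼 n) ≃ₗᵢ[ℝ] (𝔼 n)) (j : Fin n) (x : 𝔼 n) :
    R x j = inner ℝ (R.symm (EuclideanSpace.single j 1)) x := by
  rw [R.symm.inner_map_eq_flip, R.symm_symm, EuclideanSpace.inner_single_left]
  simp

/-- The three-term recurrence lowers the degree, and a rotated coordinate is a linear form. Only an
upper bound on the degree is tracked; orthogonality removes the lower degrees afterwards. -/
theorem hermiteFun_comp_isometry_mem (R : (𝔼 n) ≃ₗᵢ[ℝ] (𝔼 n)) (α : Fin n → ℕ) :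
    (fun x => hermiteFun α (R x)) ∈ hermiteFunSpan {β : Fin n → ℕ | ∑ i, β i ≤ ∑ i, α i} := by
  induction hd : ∑ i, α i using Nat.strong_induction_on generalizing α with
  | _ d ih =>
  by_cases h0 : α = 0
  · subst h0
    have h : (fun x : 𝔼 n => hermiteFun (0 : Fin n → ℕ) (R x)) = hermiteFun 0 := by
      ext x
      simp [hermiteFun]
    rw [h]
    exact hermiteFun_mem_span (by simp)
  obtain ⟨j, hj⟩ := Function.ne_iff.1 h0
  obtain ⟨k, hk⟩ := Nat.exists_eq_succ_of_ne_zero hj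
  have h1 := sum_update α j k
  have h2 := sum_update α j (k - 1)
  -- The recurrence solved for its top term, with `α j = k + 1`. When `k = 0` the last term has
  -- coefficient zero.
  have e : (fun x : 𝔼 n => hermiteFun α (R x)) =
      (fun x => inner ℝ (R.symm (EuclideanSpace.single j 1)) x *
        hermiteFun (Function.update α j k) (R x)) -
      (k : ℝ) • (fun x => hermiteFun (Function.update α j (k - 1)) (R x)) := by
    ext x
    have := coord_mul_hermiteFun_update α j k (R x)
    rw [← Nat.succ_eq_add_one, ← hk, Function.update_eq_self, isometry_apply_coord] at this
    simp [this]
  rw [e]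
  have hd1 : ∑ i, Function.update α j k i + 1 = d := by omega
  refine sub_mem ?_ (Submodule.smul_mem _ _ ?_)
  · have := inner_mul_mem_hermiteFunSpan (ih _ (by omega) (Function.update α j k) rfl)
      (R.symm (EuclideanSpace.single j 1))
    exact hermiteFunSpan_mono (fun β hβ => hβ.trans hd1.le) this
  · exact hermiteFunSpan_mono (fun β hβ => hβ.trans (by omega))
      (ih _ (by omega) (Function.update α j (k - 1)) rfl)

theorem comp_isometry_mem_of_lt (R : (𝔼 n) ≃ₗᵢ[ℝ] (𝔼 n)) {k : ℕ} {p : (𝔼 n) → ℝ}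
    (hp : p ∈ hermiteFunSpan {α : Fin n → ℕ | ∑ i, α i < k}) :
    (fun x => p (R x)) ∈ hermiteFunSpan {α : Fin n → ℕ | ∑ i, α i < k} := by
  induction hp using Submodule.span_induction with
  | mem p hp =>
    obtain ⟨α, hα, rfl⟩ := hp
    rw [Set.mem_ofPred_eq] at hα
    exact hermiteFunSpan_mono (fun β hβ => hβ.trans_lt hα) (hermiteFun_comp_isometry_mem R α)
  | zero => exact Submodule.zero_mem _
  | add p q _ _ hp hq => exact add_mem hp hq
  | smul a p _ hp => exact Submodule.smul_mem _ a hp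

/-! ### Hermite spans in `L²(γ)` -/

/-- The span of the `He_α`, `α ∈ S`, in `L²(γ)`. -/
def hermiteLpSpan (S : Set (Fin n → ℕ)) : Submodule ℝ (Lp ℝ 2 (γ n)) :=
  Submodule.span ℝ (hermiteLp '' S)

theorem coeFn_hermiteLp (α : Fin n → ℕ) : hermiteLp α =ᵐ[γ n] hermiteFun α :=
  (memLp_hermiteFun α).coeFn_toLp

theorem exists_mem_hermiteLpSpan {S : Set (Fin n → ℕ)} {p : (𝔼 n) → ℝ}
    (hp : p ∈ hermiteFunSpan S) : ∃ P ∈ hermiteLpSpan S, P =ᵐ[γ n] p := by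
  induction hp using Submodule.span_induction with
  | mem p hp =>
    obtain ⟨α, hα, rfl⟩ := hp
    exact ⟨hermiteLp α, Submodule.subset_span ⟨α, hα, rfl⟩, coeFn_hermiteLp α⟩
  | zero => exact ⟨0, Submodule.zero_mem _, Lp.coeFn_zero _ _ _⟩
  | add p q _ _ hp hq =>
    obtain ⟨P, hP, hP'⟩ := hp
    obtain ⟨Q, hQ, hQ'⟩ := hq
    exact ⟨P + Q, add_mem hP hQ, (Lp.coeFn_add P Q).trans (hP'.add hQ')⟩
  | smul a p _ hp =>
    obtain ⟨P, hP, hP'⟩ := hp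
    exact ⟨a • P, Submodule.smul_mem _ a hP, (Lp.coeFn_smul a P).trans (hP'.const_smul a)⟩

theorem exists_mem_hermiteFunSpan {S : Set (Fin n → ℕ)} {P : Lp ℝ 2 (γ n)}
    (hP : P ∈ hermiteLpSpan S) : ∃ p ∈ hermiteFunSpan S, P =ᵐ[γ n] p := by
  induction hP using Submodule.span_induction with
  | mem P hP =>
    obtain ⟨α, hα, rfl⟩ := hP
    exact ⟨hermiteFun α, hermiteFun_mem_span hα, coeFn_hermiteLp α⟩
  | zero => exact ⟨0, Submodule.zero_mem _, Lp.coeFn_zero _ _ _⟩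
  | add P Q _ _ hp hq =>
    obtain ⟨p, hp, hp'⟩ := hp
    obtain ⟨q, hq, hq'⟩ := hq
    exact ⟨p + q, add_mem hp hq, (Lp.coeFn_add P Q).trans (hp'.add hq')⟩
  | smul a P _ hp =>
    obtain ⟨p, hp, hp'⟩ := hp
    exact ⟨a • p, Submodule.smul_mem _ a hp, (Lp.coeFn_smul a P).trans (hp'.const_smul a)⟩

theorem inner_eq_integral_of_ae_eq {μ : Measure (𝔼 n)} {P Q : Lp ℝ 2 μ} {p q : (𝔼 n) → ℝ}
    (hP : P =ᵐ[μ] p) (hQ : Q =ᵐ[μ] q) : inner ℝ P Q = ∫ x, p x * q x ∂μ := by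
  rw [L2.inner_def]
  refine integral_congr_ae ?_
  filter_upwards [hP, hQ] with x h1 h2
  simp [h1, h2, mul_comm]

theorem inner_hermiteLpSpan_eq_zero {S T : Set (Fin n → ℕ)} (h : Disjoint S T)
    {P Q : Lp ℝ 2 (γ n)} (hP : P ∈ hermiteLpSpan S) (hQ : Q ∈ hermiteLpSpan T) :
    inner ℝ P Q = 0 := by
  have key : hermiteLpSpan S ⟂ hermiteLpSpan T := by
    rw [hermiteLpSpan, hermiteLpSpan, Submodule.isOrtho_span]
    rintro _ ⟨α, hα, rfl⟩ _ ⟨β, hβ, rfl⟩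
    rw [inner_eq_integral_of_ae_eq (coeFn_hermiteLp α) (coeFn_hermiteLp β)]
    exact integral_hermiteFun_mul_of_ne fun e => Set.disjoint_left.1 h hα (e ▸ hβ)
  exact Submodule.isOrtho_iff_inner_eq.1 key P hP Q hQ

/-! ### Rotation invariance of the Hermite spaces -/

theorem measurePreserving_isometry (R : (𝔼 n) ≃ₗᵢ[ℝ] (𝔼 n)) :
    MeasurePreserving R (γ n) (γ n) :=
  ⟨R.continuous.measurable, stdGaussian_map R⟩

theorem integral_comp_isometry (R : (𝔼 n) ≃ₗᵢ[ℝ] (𝔼 n)) (g : (𝔼 n) → ℝ) :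
    ∫ x, g (R x) ∂(γ n) = ∫ x, g x ∂(γ n) :=
  (measurePreserving_isometry R).integral_comp
    R.toHomeomorph.measurableEmbedding g

/-- The spaces of Hermite polynomials of degree `k` are invariant under rotations. -/
theorem exists_comp_isometry_ae_eq (R : (𝔼 n) ≃ₗᵢ[ℝ] (𝔼 n)) {k : ℕ} {p : (𝔼 n) → ℝ}
    (hp : p ∈ hermiteFunSpan {α : Fin n → ℕ | ∑ i, α i = k}) :
    ∃ q ∈ hermiteFunSpan {α : Fin n → ℕ | ∑ i, α i = k}, (fun x => p (R x)) =ᵐ[γ n] q := by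
  induction hp using Submodule.span_induction with
  | mem p hp =>
    obtain ⟨α, hα, rfl⟩ := hp
    simp only [Set.mem_ofPred_eq] at hα
    obtain ⟨G, hG, hG'⟩ := exists_mem_hermiteLpSpan (hermiteFun_comp_isometry_mem R α)
    have hU : {β : Fin n → ℕ | ∑ i, β i ≤ ∑ i, α i} =
        {β : Fin n → ℕ | ∑ i, β i = k} ∪ {β : Fin n → ℕ | ∑ i, β i < k} := by
      ext β
      simp only [Set.mem_ofPred_eq, Set.mem_union]
      omega
    -- Split the rotated polynomial into its degree-`k` part `a` and lower part `b`. Undoing the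
    -- rotation on the lower-degree factor shows `a + b` orthogonal to `b`; as `a` is too, `b = 0`.
    rw [hU, hermiteLpSpan, Set.image_union, Submodule.span_union] at hG
    obtain ⟨a, ha, b, hb, rfl⟩ := Submodule.mem_sup.1 hG
    have hab : inner ℝ a b = 0 := inner_hermiteLpSpan_eq_zero
      (Set.disjoint_left.2 fun β h1 h2 => by simp only [Set.mem_ofPred_eq] at h1 h2; omega) ha hb
    have hGb : inner ℝ (a + b) b = 0 := by
      obtain ⟨q, hq, hq'⟩ := exists_mem_hermiteFunSpan hb
      rw [inner_eq_integral_of_ae_eq hG' hq']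
      have h1 := integral_comp_isometry R fun x => hermiteFun α x * q (R.symm x)
      simp only [R.symm_apply_apply] at h1
      rw [h1]
      obtain ⟨Q, hQ, hQ'⟩ := exists_mem_hermiteLpSpan (comp_isometry_mem_of_lt R.symm hq)
      rw [← inner_eq_integral_of_ae_eq (coeFn_hermiteLp α) hQ']
      refine inner_hermiteLpSpan_eq_zero (S := {β : Fin n → ℕ | ∑ i, β i = k}) ?_
        (Submodule.subset_span ⟨α, hα, rfl⟩) hQ
      exact Set.disjoint_left.2 fun β h1 h2 => by simp only [Set.mem_ofPred_eq] at h1 h2; omega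
    have hb0 : b = 0 := by
      rw [inner_add_left, hab, zero_add] at hGb
      exact inner_self_eq_zero.1 hGb
    rw [hb0, add_zero] at hG'
    obtain ⟨q, hq, hq'⟩ := exists_mem_hermiteFunSpan ha
    exact ⟨q, hq, hG'.symm.trans hq'⟩
  | zero => exact ⟨0, Submodule.zero_mem _, Filter.EventuallyEq.rfl⟩
  | add p q _ _ hp hq =>
    obtain ⟨P, hP, hP'⟩ := hp
    obtain ⟨Q, hQ, hQ'⟩ := hq
    exact ⟨P + Q, add_mem hP hQ, hP'.add hQ'⟩
  | smul a p _ hp =>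
    obtain ⟨P, hP, hP'⟩ := hp
    exact ⟨a • P, Submodule.smul_mem _ a hP, hP'.const_smul a⟩

/-- The reflection in the hyperplane orthogonal to `e_j - u` exchanges the unit vectors `e_j` and
`u`. -/
theorem exists_isometry_coord (j : Fin n) {u : 𝔼 n} (hu : ‖u‖ = 1) :
    ∃ R : (𝔼 n) ≃ₗᵢ[ℝ] (𝔼 n), ∀ x, R x j = inner ℝ u x := by
  have h : ‖EuclideanSpace.single j (1 : ℝ)‖ = ‖u‖ := by simp [hu]
  refine ⟨(Submodule.reflection (ℝ ∙ (EuclideanSpace.single j (1 : ℝ) - u))ᗮ), fun x => ?_⟩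
  rw [isometry_apply_coord, Submodule.reflection_symm, Submodule.reflection_sub h]

/-! ### Hermite polynomials of degree three on a slab -/

/-- The indicator function of `[-c, c]`. -/
def slab (c t : ℝ) : ℝ := if |t| ≤ c then 1 else 0

theorem measurable_slab (c : ℝ) : Measurable (slab c) :=
  Measurable.ite (measurableSet_le measurable_norm measurable_const)
    measurable_const measurable_const

theorem slab_nonneg (c t : ℝ) : 0 ≤ slab c t := by
  unfold slab
  split_ifs <;> norm_num

theorem slab_le_one (c t : ℝ) : slab c t ≤ 1 := by
  unfold slab
  split_ifs <;> norm_num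

theorem slab_mul_self (c t : ℝ) : slab c t * slab c t = slab c t := by
  unfold slab
  split_ifs <;> norm_num

theorem integrable_slab_mul {Ω : Type*} [MeasurableSpace Ω] {μ : Measure Ω} {h g : Ω → ℝ} (c : ℝ)
    (hh : Measurable h) (hg : Integrable g μ) : Integrable (fun x => slab c (h x) * g x) μ := by
  refine hg.bdd_mul (c := 1) ((measurable_slab c).comp hh).aestronglyMeasurable
    (.of_forall fun x => ?_)
  rw [Real.norm_of_nonneg (slab_nonneg _ _)]
  exact slab_le_one _ _

/-- For `k ≤ 3` the bound He_k² ≤ k! already holds pointwise on [-1, 1]. -/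
theorem integral_slab_hermite_sq_le {c : ℝ} (hc : c ≤ 1) {k : ℕ} (hk : k ≤ 3) :
    ∫ t, slab c t * ((hermiteReal k).eval t * (hermiteReal k).eval t) ∂γ₁ ≤
      (∫ t, slab c t ∂γ₁) * k.factorial := by
  rw [← integral_mul_const]
  refine integral_mono ?_ ?_ fun t => ?_
  · refine integrable_slab_mul c measurable_id ?_
    simpa using integrable_eval_γ₁ (hermiteReal k * hermiteReal k)
  · exact integrable_slab_mul c measurable_id (integrable_const _)
  · unfold slab
    dsimp only
    split_ifs with ht
    · have h1 : t ^ 2 ≤ 1 := by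
        rw [← sq_abs]
        nlinarith [abs_nonneg t]
      have h0 := sq_nonneg t
      interval_cases k <;>
        simp only [hermiteReal_zero, hermiteReal_one_eval, hermiteReal_two_eval,
          hermiteReal_three_eval, Polynomial.eval_one, Nat.factorial] <;> norm_num
      · nlinarith
      · nlinarith
      · nlinarith [mul_nonneg h0 h0, mul_nonneg (mul_nonneg h0 h0) (sub_nonneg.2 h1)]
    · simp

theorem integrable_hermiteFun_mul (α β : Fin n → ℕ) :
    Integrable (fun x => hermiteFun α x * hermiteFun β x) (γ n) :=
  (memLp_hermiteFun α).integrable_mul (memLp_hermiteFun β)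

/-- A weight in one coordinate keeps the degree-three Hermite basis orthogonal, so both sides are
diagonal quadratic forms and can be compared coefficient by coefficient. -/
theorem integral_slab_sq_le_of_coord {c : ℝ} (hc : c ≤ 1) (j : Fin n) {p : (𝔼 n) → ℝ}
    (hp : p ∈ hermiteFunSpan {α : Fin n → ℕ | ∑ i, α i = 3}) :
    ∫ x, slab c (x j) * p x ^ 2 ∂(γ n) ≤ (∫ t, slab c t ∂γ₁) * ∫ x, p x ^ 2 ∂(γ n) := by
  have hS : {α : Fin n → ℕ | ∑ i, α i = 3} =
      (Finset.piAntidiag (Finset.univ : Finset (Fin n)) 3 : Finset (Fin n → ℕ)) := by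
    ext α
    simp
  rw [hermiteFunSpan, hS, Submodule.mem_span_image_finset_iff_exists_fun'] at hp
  obtain ⟨a, rfl⟩ := hp
  set s := Finset.piAntidiag (Finset.univ : Finset (Fin n)) 3
  have hs : ∀ α ∈ s, ∑ i, α i = 3 := fun α hα => (Finset.mem_piAntidiag.1 hα).1
  have hj : Measurable fun x : 𝔼 n => x j := by fun_prop
  have expand : ∀ w : ℝ → ℝ, (∀ α β : Fin n → ℕ,
      Integrable (fun x => w (x j) * (hermiteFun α x * hermiteFun β x)) (γ n)) →
      ∫ x, w (x j) * (∑ α ∈ s, a α • hermiteFun α) x ^ 2 ∂(γ n) =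
        ∑ α ∈ s, a α ^ 2 * ∫ x, w (x j) * (hermiteFun α x * hermiteFun α x) ∂(γ n) := by
    intro w hw
    have e : ∀ x : 𝔼 n, w (x j) * (∑ α ∈ s, a α • hermiteFun α) x ^ 2 =
        ∑ α ∈ s, ∑ β ∈ s, a α * a β * (w (x j) * (hermiteFun α x * hermiteFun β x)) := by
      intro x
      rw [Finset.sum_apply, sq, Finset.sum_mul_sum, Finset.mul_sum]
      refine Finset.sum_congr rfl fun α _ => ?_
      rw [Finset.mul_sum]
      refine Finset.sum_congr rfl fun β _ => ?_
      simp only [Pi.smul_apply, smul_eq_mul]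
      ring
    simp_rw [e]
    rw [integral_finsetSum _ fun α _ => integrable_finsetSum _ fun β _ => (hw α β).const_mul _]
    refine Finset.sum_congr rfl fun α hα => ?_
    rw [integral_finsetSum _ fun β _ => (hw α β).const_mul _, Finset.sum_eq_single_of_mem α hα]
    · rw [integral_const_mul, sq]
    · intro β hβ hne
      rw [integral_const_mul, integral_weight_hermiteFun_mul_of_ne w j
        ((hs α hα).trans (hs β hβ).symm) hne.symm, mul_zero]
  have h1 := expand (fun _ => 1) fun α β => by
    simpa using integrable_hermiteFun_mul α β
  simp only [one_mul] at h1
  rw [expand (slab c) fun α β => integrable_slab_mul c hj (integrable_hermiteFun_mul α β), h1,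
    Finset.mul_sum]
  refine Finset.sum_le_sum fun α hα => ?_
  rw [mul_left_comm]
  refine mul_le_mul_of_nonneg_left ?_ (sq_nonneg _)
  rw [integral_weight_hermiteFun_mul, integral_hermiteFun_sq,
    ← Finset.mul_prod_erase _ _ (Finset.mem_univ j), ← mul_assoc]
  simp only [if_true]
  refine mul_le_mul_of_nonneg_right (integral_slab_hermite_sq_le hc ?_) (by positivity)
  rw [← hs α hα]
  exact Finset.single_le_sum (fun i _ => Nat.zero_le _) (Finset.mem_univ j)

theorem integral_slab_inner_sq_le {c : ℝ} (hc : c ≤ 1) (j : Fin n) {u : 𝔼 n} (hu : ‖u‖ = 1)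
    {P : Lp ℝ 2 (γ n)} (hP : P ∈ hermiteSpace n 3) :
    ∫ x, slab c (inner ℝ u x) * P x ^ 2 ∂(γ n) ≤
      (∫ t, slab c t ∂γ₁) * ∫ x, P x ^ 2 ∂(γ n) := by
  obtain ⟨p, hp, hPp⟩ := exists_mem_hermiteFunSpan hP
  obtain ⟨R, hR⟩ := exists_isometry_coord j hu
  obtain ⟨q, hq, hpq⟩ := exists_comp_isometry_ae_eq R.symm hp
  have key := integral_slab_sq_le_of_coord hc j hq
  have e1 : ∫ x, slab c (inner ℝ u x) * P x ^ 2 ∂(γ n) =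
      ∫ x, slab c (x j) * q x ^ 2 ∂(γ n) := by
    rw [integral_congr_ae (g := fun x => slab c (inner ℝ u x) * p x ^ 2)
      (hPp.mono fun x hx => by simp only [hx]), ← integral_comp_isometry R.symm]
    refine integral_congr_ae (hpq.mono fun x hx => ?_)
    simp only [← hR, R.apply_symm_apply, ← hx]
  have e2 : ∫ x, P x ^ 2 ∂(γ n) = ∫ x, q x ^ 2 ∂(γ n) := by
    rw [integral_congr_ae (g := fun x => p x ^ 2)
      (hPp.mono fun x hx => by simp only [hx]), ← integral_comp_isometry R.symm]
    exact integral_congr_ae (hpq.mono fun x hx => by simp only [← hx])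
  rw [e1, e2]
  exact key

theorem exists_hermite_three_inner (j : Fin n) {u : 𝔼 n} (hu : ‖u‖ = 1) :
    ∃ Q ∈ hermiteSpace n 3, Q =ᵐ[γ n] fun x => inner ℝ u x ^ 3 - 3 * inner ℝ u x := by
  obtain ⟨R, hR⟩ := exists_isometry_coord j hu
  have hα : Function.update (0 : Fin n → ℕ) j 3 ∈ {α : Fin n → ℕ | ∑ i, α i = 3} := by
    have := sum_update (0 : Fin n → ℕ) j 3
    simpa using this
  obtain ⟨q, hq, hq'⟩ := exists_comp_isometry_ae_eq R (hermiteFun_mem_span hα)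
  obtain ⟨Q, hQ, hQ'⟩ := exists_mem_hermiteLpSpan hq
  refine ⟨Q, hQ, hQ'.trans (hq'.symm.trans (.of_forall fun x => ?_))⟩
  simp only [hermiteFun_update, hR, hermiteReal_three_eval]
  simp [hermiteReal_zero]

/-! ### Hermite polynomials of degree one -/

theorem exists_ae_eq_inner {P : Lp ℝ 2 (γ n)} (hP : P ∈ hermiteSpace n 1) :
    ∃ v : 𝔼 n, P =ᵐ[γ n] fun x => inner ℝ v x := by
  induction hP using Submodule.span_induction with
  | mem P hP =>
    obtain ⟨α, hα, rfl⟩ := hP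
    rw [Set.mem_ofPred_eq] at hα
    obtain ⟨j, hj⟩ : ∃ j, α j ≠ 0 := by
      by_contra! h
      simp [h] at hα
    have h1 := Finset.add_sum_erase Finset.univ α (Finset.mem_univ j)
    have h2 : α j = 1 := by omega
    have h3 : ∑ i ∈ Finset.univ.erase j, α i = 0 := by omega
    rw [Finset.sum_eq_zero_iff] at h3
    refine ⟨EuclideanSpace.single j 1, (coeFn_hermiteLp α).trans (.of_forall fun x => ?_)⟩
    dsimp only
    rw [hermiteFun_eq, ← Finset.mul_prod_erase _ _ (Finset.mem_univ j), h2, hermiteReal_one_eval,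
      Finset.prod_eq_one fun i hi => by simp [h3 i hi, hermiteReal_zero],
      EuclideanSpace.inner_single_left]
    simp
  | zero => exact ⟨0, (Lp.coeFn_zero _ _ _).trans (.of_forall fun x => by simp)⟩
  | add P Q _ _ hp hq =>
    obtain ⟨v, hv⟩ := hp
    obtain ⟨w, hw⟩ := hq
    refine ⟨v + w, (Lp.coeFn_add P Q).trans ((hv.add hw).trans (.of_forall fun x => ?_))⟩
    simp [inner_add_left]
  | smul a P _ hp =>
    obtain ⟨v, hv⟩ := hp
    refine ⟨a • v, (Lp.coeFn_smul a P).trans ((hv.const_smul a).trans (.of_forall fun x => ?_))⟩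
    simp [inner_smul_left]

theorem exists_coord (j : Fin n) : ∃ Q ∈ hermiteSpace n 1, Q =ᵐ[γ n] fun x => x j := by
  have hα : Function.update (0 : Fin n → ℕ) j 1 ∈ {α : Fin n → ℕ | ∑ i, α i = 1} := by
    have := sum_update (0 : Fin n → ℕ) j 1
    simpa using this
  refine ⟨hermiteLp _, Submodule.subset_span ⟨_, hα, rfl⟩,
    (coeFn_hermiteLp _).trans (.of_forall fun x => ?_)⟩
  simp [hermiteFun_update, hermiteReal_one_eval, hermiteReal_zero]

/-! ### One-dimensional Gaussian integrals -/

theorem integral_abs_γ₁ (g : ℝ → ℝ) :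
    ∫ t, g |t| ∂γ₁ = 2 * ∫ t in Set.Ioi 0, phi t * g t := by
  rw [integral_γ₁, ← integral_comp_abs (f := fun t => phi t * g t)]
  refine integral_congr_ae (.of_forall fun t => ?_)
  have : phi |t| = phi t := by simp [phi]
  simp only [this]

/-- The integrand is the derivative of `-(phi * q)`, which vanishes at infinity. -/
theorem integral_Ioi_phi_mul (q : Polynomial ℝ) (c : ℝ) :
    ∫ t in Set.Ioi c, phi t * (t * q.eval t - q.derivative.eval t) = phi c * q.eval c := by
  have hd : ∀ t, HasDerivAt (fun t => -(phi t * q.eval t))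
      (phi t * (t * q.eval t - q.derivative.eval t)) t := fun t => by
    refine ((hasDerivAt_phi t).mul (q.hasDerivAt t)).neg.congr_deriv ?_
    ring
  have h1 : Integrable fun t => phi t * (t * q.eval t - q.derivative.eval t) :=
    (integrable_γ₁_iff _).1 ((integrable_eval_γ₁ (Polynomial.X * q - q.derivative)).congr
      (.of_forall fun x => by simp))
  have h2 : Integrable fun t => -(phi t * q.eval t) :=
    ((integrable_γ₁_iff _).1 (integrable_eval_γ₁ q)).neg
  rw [integral_Ioi_of_hasDerivAt_of_tendsto' (fun t _ => hd t) h1.integrableOn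
    (tendsto_zero_of_hasDerivAt_of_integrableOn_Ioi (a := c) (fun t _ => hd t) h1.integrableOn
      h2.integrableOn)]
  ring

theorem phi_le (x : ℝ) : phi x ≤ 2 / 5 := by
  have h1 : phi x ^ 2 ≤ 1 / (2 * Real.pi) := by
    rw [phi_sq]
    refine mul_le_of_le_one_right (by positivity) (Real.exp_le_one_iff.2 ?_)
    nlinarith [sq_nonneg x]
  have h2 : 1 / (2 * Real.pi) < 4 / 25 := by
    rw [div_lt_div_iff₀ (by positivity) (by norm_num)]
    linarith [Real.pi_gt_d2]
  nlinarith [phi_pos x]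

theorem integral_phi_eq_half_sub (c : ℝ) : ∫ t in (0 : ℝ)..c, phi t = 1 / 2 - Phi (-c) := by
  rw [intervalIntegral.integral_eq_sub_of_hasDerivAt (f := fun t => -Phi (-t))
      (fun t _ => ?_) (continuous_phi.intervalIntegrable _ _), neg_zero, Phi_zero]
  · ring
  · refine ((hasDerivAt_Phi (-t)).comp t (hasDerivAt_neg t)).neg.congr_deriv ?_
    rw [phi_neg]
    ring

theorem integral_slab_γ₁ {c : ℝ} (hc : 0 ≤ c) : ∫ t, slab c t ∂γ₁ = 1 - 2 * Phi (-c) := by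
  have e : ∀ t, slab c t = Set.indicator (Set.Iic c) 1 |t| := fun t => by
    simp [slab, Set.indicator]
  simp_rw [e]
  rw [integral_abs_γ₁]
  have e2 : ∀ t, phi t * Set.indicator (Set.Iic c) 1 t = Set.indicator (Set.Iic c) phi t := by
    intro t
    by_cases h : t ≤ c <;> simp [h]
  simp_rw [e2]
  rw [setIntegral_indicator measurableSet_Iic, Set.Ioi_inter_Iic,
    ← intervalIntegral.integral_of_le hc, integral_phi_eq_half_sub]
  ring

/-- Used with `q = 1` and `q = X ^ 2 - 1`, for which the integrand is |t| and He_3(|t|) off the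
slab. -/
theorem integral_off_slab {c : ℝ} (hc : 0 ≤ c) (q : Polynomial ℝ) :
    ∫ t, (1 - slab c t) * (|t| * q.eval |t| - q.derivative.eval |t|) ∂γ₁ =
      2 * (phi c * q.eval c) := by
  have e := integral_abs_γ₁ fun t => (1 - slab c t) * (t * q.eval t - q.derivative.eval t)
  have es : ∀ t, slab c |t| = slab c t := fun t => by simp [slab]
  simp only [es] at e
  rw [e, ← integral_Ioi_phi_mul]
  have e2 : ∀ t ∈ Set.Ioi (0 : ℝ),
      phi t * ((1 - slab c t) * (t * q.eval t - q.derivative.eval t)) =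
      Set.indicator (Set.Ioi c) (fun t => phi t * (t * q.eval t - q.derivative.eval t)) t := by
    intro t ht
    rw [Set.mem_Ioi] at ht
    by_cases h : t ≤ c
    · simp [slab, abs_of_pos ht, h]
    · simp [slab, abs_of_pos ht, h, not_le.1 h]
  rw [setIntegral_congr_fun measurableSet_Ioi e2, setIntegral_indicator measurableSet_Ioi,
    Set.Ioi_inter_Ioi, sup_eq_right.2 hc]

theorem integral_abs_off_slab {c : ℝ} (hc : 0 ≤ c) :
    ∫ t, (1 - slab c t) * |t| ∂γ₁ = 2 * phi c := by
  simpa using integral_off_slab hc 1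

theorem integral_hermite_three_off_slab {c : ℝ} (hc : 0 ≤ c) :
    ∫ t, (1 - slab c t) * (|t| ^ 3 - 3 * |t|) ∂γ₁ = -(2 * phi c) * (1 - c ^ 2) := by
  have h := integral_off_slab hc (Polynomial.X ^ 2 - 1)
  simp only [Polynomial.eval_sub, Polynomial.eval_pow, Polynomial.eval_X, Polynomial.eval_one,
    Polynomial.derivative_sub, Polynomial.derivative_X_pow, Polynomial.derivative_one,
    Polynomial.eval_mul, Polynomial.eval_C, sub_zero] at h
  convert h using 1
  · refine integral_congr_ae (.of_forall fun t => ?_)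
    push_cast
    ring
  · ring

/-- The factor `4 / 5` is the density bound `2 / 5` counted on both half-lines. -/
theorem integral_indicator_abs_le {g : ℝ → ℝ} (hg : Continuous g) (hg0 : ∀ t, 0 ≤ g t)
    {b₁ b₂ : ℝ} (hb : b₁ ≤ b₂) :
    ∫ t, Set.indicator (Set.Icc b₁ b₂) g |t| ∂γ₁ ≤ 4 / 5 * ∫ t in b₁..b₂, g t := by
  rw [integral_abs_γ₁, intervalIntegral.integral_of_le hb, ← integral_Icc_eq_integral_Ioc]
  have hi : IntegrableOn g (Set.Icc b₁ b₂) := hg.integrableOn_Icc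
  have h1 : ∫ t in Set.Ioi 0, phi t * Set.indicator (Set.Icc b₁ b₂) g t ≤
      ∫ t, 2 / 5 * Set.indicator (Set.Icc b₁ b₂) g t := by
    have hn : ∀ t, 0 ≤ Set.indicator (Set.Icc b₁ b₂) g t :=
      fun t => Set.indicator_nonneg (fun t _ => hg0 t) t
    have hI := (integrable_indicator_iff measurableSet_Icc).2 hi
    refine (setIntegral_le_integral (hI.bdd_mul (c := 2 / 5)
      continuous_phi.aestronglyMeasurable (.of_forall fun t => ?_))
      (.of_forall fun t => mul_nonneg (phi_pos t).le (hn t))).trans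
      (integral_mono (hI.bdd_mul (c := 2 / 5)
      continuous_phi.aestronglyMeasurable (.of_forall fun t => ?_)) (hI.const_mul _) fun t =>
        mul_le_mul_of_nonneg_right (phi_le t) (hn t)) <;>
    · rw [Real.norm_of_nonneg (phi_pos t).le]
      exact phi_le t
  rw [integral_const_mul, integral_indicator measurableSet_Icc] at h1
  linarith

/-! ### Numerical estimates for `C*` -/

theorem Cstar_mem : Cstar ∈ Set.Ioo (0 : ℝ) 1 := existsUnique_root.choose_spec.1.1

theorem rootFun_Cstar : rootFun Cstar = 0 := existsUnique_root.choose_spec.1.2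

theorem rootFun_strictMonoOn : StrictMonoOn rootFun (Set.Icc 0 1) := by
  refine strictMonoOn_of_deriv_pos (convex_Icc 0 1)
    (continuous_iff_continuousAt.2 fun x => (hasDerivAt_rootFun x).continuousAt).continuousOn
    fun x hx => ?_
  rw [interior_Icc] at hx
  rw [(hasDerivAt_rootFun x).deriv]
  have h3 : 0 < 1 - 2 * x * phi x := by nlinarith [hx.1, hx.2, phi_lt_half x, phi_pos x]
  have := phi_pos x
  positivity

theorem exp_neg_lower : 0.93656 ≤ Real.exp (-(0.256 : ℝ) ^ 2) := by
  have h := Real.exp_bound (x := -(0.256 : ℝ) ^ 2) (by norm_num [abs_le]) (n := 4) (by norm_num)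
  rw [abs_le] at h
  norm_num [Finset.sum_range_succ, Nat.factorial] at h ⊢
  linarith [h.1]

theorem exp_neg_upper : Real.exp (-(0.25 : ℝ) ^ 2) ≤ 0.93942 := by
  have h := Real.exp_bound (x := -(0.25 : ℝ) ^ 2) (by norm_num [abs_le]) (n := 4) (by norm_num)
  rw [abs_le] at h
  norm_num [Finset.sum_range_succ, Nat.factorial] at h ⊢
  linarith [h.2]

theorem four_phi_sq (x : ℝ) : 4 * phi x ^ 2 = 2 / Real.pi * Real.exp (-x ^ 2) := by
  rw [phi_sq]
  field_simp
  norm_num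

theorem two_div_pi_bounds : 0.636619 ≤ 2 / Real.pi ∧ 2 / Real.pi ≤ 0.63662 := by
  constructor
  · rw [le_div_iff₀ Real.pi_pos]
    nlinarith [Real.pi_lt_d6]
  · rw [div_le_iff₀ Real.pi_pos]
    nlinarith [Real.pi_gt_d6]

theorem phi_zero_lower : 0.39894 ≤ phi 0 := by
  have h := four_phi_sq 0
  norm_num at h
  have := two_div_pi_bounds.1
  have := phi_pos 0
  nlinarith

/-- `rootFun` is increasing on [0, 1] and positive at 0.256; the Gaussian mass of [0, 0.256] is
bounded below through exp(s) ≥ 1 + s. -/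
theorem Cstar_lt : Cstar < 0.256 := by
  by_contra! hc
  have h1 : rootFun 0.256 ≤ rootFun Cstar :=
    rootFun_strictMonoOn.monotoneOn ⟨by norm_num, by norm_num⟩
      (Set.Ioo_subset_Icc_self Cstar_mem) hc
  have h2 : ∫ t in (0 : ℝ)..0.256, phi 0 * (1 - t ^ 2 / 2) ≤ ∫ t in (0 : ℝ)..0.256, phi t := by
    refine intervalIntegral.integral_mono_on (by norm_num)
      (Continuous.intervalIntegrable (by fun_prop) _ _)
      (continuous_phi.intervalIntegrable _ _) fun t _ => ?_
    have h3 := Real.add_one_le_exp (-t ^ 2 / 2)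
    have h4 : phi t = phi 0 * Real.exp (-t ^ 2 / 2) := by simp [phi]
    rw [h4]
    exact mul_le_mul_of_nonneg_left (by linarith) (phi_pos 0).le
  have h3 : ∫ t in (0 : ℝ)..0.256, phi 0 * (1 - t ^ 2 / 2) = phi 0 * (0.256 - 0.256 ^ 3 / 6) := by
    rw [intervalIntegral.integral_const_mul, intervalIntegral.integral_sub
      (by simp) (Continuous.intervalIntegrable (by fun_prop) _ _),
      intervalIntegral.integral_div, integral_pow]
    norm_num
  rw [integral_phi_eq_half_sub, h3] at h2
  have h4 := four_phi_sq 0.256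
  have h5 : 0.636619 * 0.93656 ≤ 2 / Real.pi * Real.exp (-0.256 ^ 2) :=
    mul_le_mul two_div_pi_bounds.1 exp_neg_lower (by norm_num) (by positivity)
  have h6 := phi_zero_lower
  rw [rootFun_Cstar, rootFun] at h1
  norm_num at h2 h4 h5 h6 h1
  linarith

theorem lt_Cstar : 0.25 < Cstar := by
  by_contra! hc
  have h1 : rootFun Cstar ≤ rootFun 0.25 :=
    rootFun_strictMonoOn.monotoneOn (Set.Ioo_subset_Icc_self Cstar_mem)
      ⟨by norm_num, by norm_num⟩ hc
  have h2 : ∫ t in (0 : ℝ)..0.25, phi t ≤ ∫ t in (0 : ℝ)..0.25, (2 / 5 : ℝ) :=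
    intervalIntegral.integral_mono_on (by norm_num) (continuous_phi.intervalIntegrable _ _)
      (by simp) fun t _ => phi_le t
  rw [integral_phi_eq_half_sub] at h2
  have h4 := four_phi_sq 0.25
  have h5 : 2 / Real.pi * Real.exp (-0.25 ^ 2) ≤ 0.63662 * 0.93942 :=
    mul_le_mul two_div_pi_bounds.2 exp_neg_upper (by positivity) (by norm_num)
  rw [rootFun_Cstar, rootFun] at h1
  norm_num at h2 h4 h5 h1
  linarith

/-- The norm `2 φ(C*)` of the linear part of an optimal pair. -/
def Astar : ℝ := 2 * phi Cstar

theorem Astar_sq : Astar ^ 2 = 2 / Real.pi * Real.exp (-Cstar ^ 2) := by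
  rw [Astar, ← four_phi_sq]
  ring

theorem Astar_sq_lower : 0.5962 ≤ Astar ^ 2 := by
  rw [Astar_sq]
  have h1 := mul_le_mul two_div_pi_bounds.1 exp_neg_lower (by norm_num) (by positivity)
  have h2 : Real.exp (-(0.256 : ℝ) ^ 2) ≤ Real.exp (-Cstar ^ 2) :=
    Real.exp_le_exp.2 (by nlinarith [Cstar_lt, lt_Cstar])
  have h3 := mul_le_mul_of_nonneg_left h2 (show 0 ≤ 2 / Real.pi by positivity)
  norm_num at h1 h3 ⊢
  linarith

theorem Astar_sq_upper : Astar ^ 2 ≤ 0.5985 := by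
  rw [Astar_sq]
  have h1 := mul_le_mul two_div_pi_bounds.2 exp_neg_upper (by positivity) (by norm_num)
  have h2 : Real.exp (-Cstar ^ 2) ≤ Real.exp (-(0.25 : ℝ) ^ 2) :=
    Real.exp_le_exp.2 (by nlinarith [Cstar_lt, lt_Cstar])
  have h3 := mul_le_mul_of_nonneg_left h2 (show 0 ≤ 2 / Real.pi by positivity)
  norm_num at h1 h3 ⊢
  linarith

theorem Astar_pos : 0 < Astar := by
  have := phi_pos Cstar
  unfold Astar
  positivity

theorem Astar_lower : 0.77 ≤ Astar := by
  nlinarith [Astar_sq_lower, Astar_pos]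

theorem Astar_upper : Astar ≤ 0.78 := by
  nlinarith [Astar_sq_upper, Astar_pos]

theorem lamStar_eq : lamStar = Cstar * Astar := by
  rw [lamStar, Astar]
  ring

theorem lamStar_lower : 0.1925 ≤ lamStar := by
  rw [lamStar_eq]
  nlinarith [Astar_lower, lt_Cstar]

theorem lamStar_upper : lamStar ≤ 0.2 := by
  rw [lamStar_eq]
  nlinarith [Astar_upper, Cstar_lt, Astar_pos]

/-- This is the defining equation of `Cstar` rewritten: it ties the mass of the slab to the linear
moment of `optSign`. -/
theorem integral_slab_Cstar : ∫ t, slab Cstar t ∂γ₁ = (1 - Astar ^ 2) / 2 := by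
  rw [integral_slab_γ₁ Cstar_mem.1.le, Astar]
  have := rootFun_Cstar
  rw [rootFun] at this
  linarith

/-- The source of the constant 0.046: the lower bound for the ideal ‖Π_3 F‖² minus the upper bound
for the ideal ‖Π_3 D‖². The margin is thin, which is why `Cstar` is enclosed so tightly. -/
theorem degree_three_gap :
    0.046 ≤ (Astar * (1 - Cstar ^ 2)) ^ 2 / 6 - ((1 - Astar ^ 2) / 2) ^ 2 := by
  have h1 := Astar_sq_lower
  have h2 := Astar_sq_upper
  have h3 : 0.934464 ≤ 1 - Cstar ^ 2 := by nlinarith [Cstar_lt, lt_Cstar]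
  have h4 : 0.934464 ^ 2 ≤ (1 - Cstar ^ 2) ^ 2 := by
    apply pow_le_pow_left₀ (by norm_num) h3
  have h5 : 0.5962 * 0.934464 ^ 2 ≤ Astar ^ 2 * (1 - Cstar ^ 2) ^ 2 :=
    mul_le_mul h1 h4 (by norm_num) (sq_nonneg _)
  have h6 : ((1 - Astar ^ 2) / 2) ^ 2 ≤ ((1 - 0.5962) / 2) ^ 2 :=
    pow_le_pow_left₀ (by linarith) (by linarith) 2
  rw [mul_pow]
  norm_num at h5 h6 ⊢
  linarith

/-! ### Stability of the one-dimensional Davie–Reeds problem -/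

/-- The sign function, set to zero on the slab `|t| ≤ C*`. -/
def optSign (t : ℝ) : ℝ := if |t| ≤ Cstar then 0 else if 0 < t then 1 else -1

theorem measurable_optSign : Measurable optSign :=
  Measurable.ite (measurableSet_le measurable_norm measurable_const) measurable_const
    (Measurable.ite measurableSet_Ioi measurable_const measurable_const)

/-- The loss `(A|t| - λ)₊ - (A y t - λ y²)` at `A = A*`. -/
def loss (y t : ℝ) : ℝ :=
  (1 - slab Cstar t) * (Astar * |t| - lamStar) - (Astar * (y * t) - lamStar * y ^ 2)

/-- As λ = C·A, the maximum of A y t - λ y² over the three values of `y` is attained at `optSign t`,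
and each unit of distance from it costs at least |A|t| - λ|. -/
theorem dist_mul_le_loss {y : ℝ} (hy : y = -1 ∨ y = 0 ∨ y = 1) (t : ℝ) :
    |y - optSign t| * |Astar * |t| - lamStar| ≤ loss y t := by
  have hA := Astar_pos
  have hc := Cstar_mem.1
  rw [loss, optSign, slab, lamStar_eq]
  rcases le_or_gt |t| Cstar with ht | ht
  · have h1 : Astar * |t| - Cstar * Astar ≤ 0 := by nlinarith
    have h2 := neg_abs_le t
    have h3 := le_abs_self t
    rw [abs_of_nonpos h1]
    rcases hy with rfl | rfl | rfl <;> simp only [if_pos ht] <;> norm_num <;> nlinarith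
  · have h1 : 0 ≤ Astar * |t| - Cstar * Astar := by nlinarith
    rw [abs_of_nonneg h1]
    simp only [if_neg ht.not_ge]
    rcases le_or_gt t 0 with h0 | h0
    · rw [if_neg h0.not_gt]
      rw [abs_of_nonpos h0] at h1 ht ⊢
      rcases hy with rfl | rfl | rfl <;> norm_num <;> nlinarith
    · rw [if_pos h0]
      rw [abs_of_pos h0] at h1 ht ⊢
      rcases hy with rfl | rfl | rfl <;> norm_num <;> nlinarith

/-- Compare with the same problem at slope `a`: a y t - λ y² is at most the positive part of a|t| -
λ. Replacing its threshold λ/a by C only matters for |t| between the two, where the error is at most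
|a - A||t|. -/
theorem linear_le_loss {y : ℝ} (hy : y = -1 ∨ y = 0 ∨ y = 1) (t : ℝ) {a : ℝ} (ha : 0 < a) :
    (a - Astar) * (y * t) - (a - Astar) * ((1 - slab Cstar t) * |t|) - |a - Astar| *
      Set.indicator (Set.Icc (min Cstar (lamStar / a)) (max Cstar (lamStar / a))) abs |t| ≤
      loss y t := by
  have hA := Astar_pos
  have hc := Cstar_mem.1
  have hl := lamStar_eq
  set I := Set.indicator (Set.Icc (min Cstar (lamStar / a)) (max Cstar (lamStar / a))) abs |t|
    with hI
  have hI0 : 0 ≤ |a - Astar| * I :=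
    mul_nonneg (abs_nonneg _) (Set.indicator_nonneg (fun _ _ => abs_nonneg _) _)
  have hη := le_abs_self (a - Astar)
  have hη' := neg_abs_le (a - Astar)
  have habs := abs_nonneg t
  have hmax : a * (y * t) - lamStar * y ^ 2 ≤ max (a * |t| - lamStar) 0 := by
    have h2 := neg_abs_le t
    have h3 := le_abs_self t
    rcases hy with rfl | rfl | rfl
    · exact le_max_of_le_left (by nlinarith)
    · exact le_max_of_le_right (by norm_num)
    · exact le_max_of_le_left (by nlinarith)
  have key : max (a * |t| - lamStar) 0 ≤
      (1 - slab Cstar t) * (a * |t| - lamStar) + |a - Astar| * I := by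
    rw [slab]
    rcases le_or_gt |t| Cstar with ht | ht
    · rw [if_pos ht]
      refine max_le ?_ (by linarith)
      rcases le_or_gt (a * |t| - lamStar) 0 with h | h
      · linarith
      · have hb : lamStar / a ≤ |t| := by
          rw [div_le_iff₀ ha]
          linarith
        rw [hI, Set.indicator_of_mem (Set.mem_Icc.2 ⟨min_le_of_right_le hb, le_max_of_le_left ht⟩),
          abs_abs]
        nlinarith
    · rw [if_neg ht.not_ge]
      refine max_le (by linarith) ?_
      rcases le_or_gt 0 (a * |t| - lamStar) with h | h
      · linarith
      · have hb : |t| ≤ lamStar / a := by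
          rw [le_div_iff₀ ha]
          linarith
        rw [hI, Set.indicator_of_mem (Set.mem_Icc.2
          ⟨min_le_of_left_le ht.le, le_max_of_le_right hb⟩), abs_abs]
        nlinarith
  rw [loss]
  linarith

section Stability

variable {Ω : Type*} [MeasurableSpace Ω] {μ : Measure Ω} {h F : Ω → ℝ}

theorem integrable_bounded_mul {k g : Ω → ℝ} {C : ℝ} (hk : Measurable k) (hb : ∀ x, |k x| ≤ C)
    (hg : Integrable g μ) : Integrable (fun x => k x * g x) μ :=
  hg.bdd_mul hk.aestronglyMeasurable (.of_forall hb)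

theorem integral_comp_of_map_eq (hh : Measurable h) (hlaw : μ.map h = γ₁) {g : ℝ → ℝ}
    (hg : Measurable g) : ∫ x, g (h x) ∂μ = ∫ t, g t ∂γ₁ := by
  rw [← hlaw, integral_map hh.aemeasurable hg.aestronglyMeasurable]

theorem memLp_eval_of_map_eq (hh : Measurable h) (hlaw : μ.map h = γ₁) (q : Polynomial ℝ) :
    MemLp (fun x => q.eval (h x)) 2 μ := by
  have := memLp_eval_γ₁ q 2 (by norm_num)
  rw [← hlaw] at this
  exact this.comp_of_map hh.aemeasurable

theorem memLp_of_map_eq (hh : Measurable h) (hlaw : μ.map h = γ₁) : MemLp h 2 μ := by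
  simpa using memLp_eval_of_map_eq hh hlaw Polynomial.X

theorem integral_sq_of_map_eq (hh : Measurable h) (hlaw : μ.map h = γ₁) :
    ∫ x, h x ^ 2 ∂μ = 1 := by
  have h1 := integral_hermite_mul_hermite 1 1
  simp only [hermiteReal_one_eval, if_true, Nat.factorial_one, Nat.cast_one, ← sq] at h1
  rw [integral_comp_of_map_eq hh hlaw (g := fun t => t ^ 2) (by fun_prop), h1]

theorem integral_hermite_three_sq_of_map_eq (hh : Measurable h) (hlaw : μ.map h = γ₁) :
    ∫ x, (h x ^ 3 - 3 * h x) ^ 2 ∂μ = 6 := by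
  have h1 := integral_hermite_mul_hermite 3 3
  simp only [hermiteReal_three_eval, if_true, ← sq] at h1
  rw [integral_comp_of_map_eq hh hlaw (g := fun t => (t ^ 3 - 3 * t) ^ 2) (by fun_prop), h1]
  norm_num [Nat.factorial]

theorem abs_le_one_of_mem {y : ℝ} (hy : y = -1 ∨ y = 0 ∨ y = 1) : |y| ≤ 1 := by
  rcases hy with rfl | rfl | rfl <;> norm_num

theorem optSign_mem (t : ℝ) : optSign t = -1 ∨ optSign t = 0 ∨ optSign t = 1 := by
  unfold optSign
  split_ifs <;> simp

theorem dist_optSign_le {y : ℝ} (hy : y = -1 ∨ y = 0 ∨ y = 1) (t : ℝ) : |y - optSign t| ≤ 2 := by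
  have h1 := abs_le.1 (abs_le_one_of_mem hy)
  have h2 := abs_le.1 (abs_le_one_of_mem (optSign_mem t))
  exact abs_le.2 ⟨by linarith, by linarith⟩

theorem integrable_off_slab_mul {g : Ω → ℝ} (hh : Measurable h) (hg : Integrable g μ) :
    Integrable (fun x => (1 - slab Cstar (h x)) * g x) μ := by
  refine integrable_bounded_mul (C := 1) (measurable_const.sub ((measurable_slab _).comp hh))
    (fun x => ?_) hg
  rw [abs_le]
  constructor <;> linarith [slab_nonneg Cstar (h x), slab_le_one Cstar (h x)]

variable [IsProbabilityMeasure μ]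

theorem integrable_sq_of_mem (hF : Measurable F) (hFv : ∀ x, F x = -1 ∨ F x = 0 ∨ F x = 1) :
    Integrable (fun x => F x ^ 2) μ := by
  refine Integrable.of_bound (hF.pow_const 2).aestronglyMeasurable 1 (.of_forall fun x => ?_)
  rcases hFv x with e | e | e <;> simp [e]

theorem integrable_loss (hh : Measurable h) (hlaw : μ.map h = γ₁) (hF : Measurable F)
    (hFv : ∀ x, F x = -1 ∨ F x = 0 ∨ F x = 1) : Integrable (fun x => loss (F x) (h x)) μ := by
  have ih : Integrable h μ := (memLp_of_map_eq hh hlaw).integrable (by norm_num)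
  have i1 : Integrable (fun x => Astar * |h x| - lamStar) μ :=
    (ih.abs.const_mul _).sub (integrable_const _)
  have i2 : Integrable (fun x => (1 - slab Cstar (h x)) * (Astar * |h x| - lamStar)) μ :=
    integrable_off_slab_mul hh i1
  have i3 : Integrable (fun x => F x * h x) μ :=
    integrable_bounded_mul hF (fun x => abs_le_one_of_mem (hFv x)) ih
  have i4 := integrable_sq_of_mem (μ := μ) hF hFv
  exact i2.sub ((i3.const_mul _).sub (i4.const_mul _))

theorem integral_loss (hh : Measurable h) (hlaw : μ.map h = γ₁) (hF : Measurable F)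
    (hFv : ∀ x, F x = -1 ∨ F x = 0 ∨ F x = 1) :
    ∫ x, loss (F x) (h x) ∂μ = Astar ^ 2 - lamStar * (1 + Astar ^ 2) / 2 -
      Astar * ∫ x, F x * h x ∂μ + lamStar * ∫ x, F x ^ 2 ∂μ := by
  have ih : Integrable h μ := (memLp_of_map_eq hh hlaw).integrable (by norm_num)
  have i1 := integrable_off_slab_mul hh ih.abs
  have i2 : Integrable (fun x => slab Cstar (h x)) μ := by
    simpa using integrable_slab_mul Cstar hh (integrable_const (1 : ℝ))
  have i2' : Integrable (fun x => 1 - slab Cstar (h x)) μ := (integrable_const _).sub i2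
  have i3 : Integrable (fun x => F x * h x) μ :=
    integrable_bounded_mul hF (fun x => abs_le_one_of_mem (hFv x)) ih
  have i4 := integrable_sq_of_mem (μ := μ) hF hFv
  have e : ∀ x, loss (F x) (h x) = Astar * ((1 - slab Cstar (h x)) * |h x|) -
      lamStar * (1 - slab Cstar (h x)) - Astar * (F x * h x) + lamStar * F x ^ 2 := fun x => by
    rw [loss]
    ring
  simp_rw [e]
  have j1 : Integrable (fun x => Astar * ((1 - slab Cstar (h x)) * |h x|) -
      lamStar * (1 - slab Cstar (h x))) μ := (i1.const_mul _).sub (i2'.const_mul _)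
  have j2 : Integrable (fun x => Astar * ((1 - slab Cstar (h x)) * |h x|) -
      lamStar * (1 - slab Cstar (h x)) - Astar * (F x * h x)) μ := j1.sub (i3.const_mul _)
  rw [integral_add j2 (i4.const_mul _), integral_sub j1 (i3.const_mul _),
    integral_sub (i1.const_mul _) (i2'.const_mul _), integral_const_mul, integral_const_mul,
    integral_const_mul, integral_const_mul, integral_sub (integrable_const _) i2,
    integral_comp_of_map_eq hh hlaw (g := fun t => (1 - slab Cstar t) * |t|)
      ((measurable_const.sub (measurable_slab _)).mul measurable_norm),
    integral_comp_of_map_eq hh hlaw (measurable_slab _), integral_slab_Cstar,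
    integral_abs_off_slab Cstar_mem.1.le]
  change Astar * Astar - _ - _ + _ = _
  simp
  ring

/-- Integrating `linear_le_loss` gives (a - A)² minus |a - A| times the moment of |t| between C and
λ/a. That window has width O(|a - A|), so the correction is at most 0.2 (a - A)². -/
theorem sq_sub_le_integral_loss (hh : Measurable h) (hlaw : μ.map h = γ₁) (hF : Measurable F)
    (hFv : ∀ x, F x = -1 ∨ F x = 0 ∨ F x = 1) {a : ℝ} (ha : ∫ x, F x * h x ∂μ = a)
    (ha' : 0.4 ≤ a) : 0.8 * (a - Astar) ^ 2 ≤ ∫ x, loss (F x) (h x) ∂μ := by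
  have hA := Astar_pos
  have hA' := Astar_upper
  have hc := Cstar_mem.1
  have hc' := Cstar_lt
  have ha0 : 0 < a := by linarith
  have hl : 0 < lamStar := by linarith [lamStar_lower]
  have ih : Integrable h μ := (memLp_of_map_eq hh hlaw).integrable (by norm_num)
  set b₁ := min Cstar (lamStar / a) with hb₁
  set b₂ := max Cstar (lamStar / a) with hb₂
  have hb0 : 0 < b₁ := lt_min hc (by positivity)
  have hb : b₁ ≤ b₂ := min_le_max
  have i1 := integrable_off_slab_mul hh ih.abs
  have i3 : Integrable (fun x => F x * h x) μ :=
    integrable_bounded_mul hF (fun x => abs_le_one_of_mem (hFv x)) ih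
  have mI : Measurable fun t : ℝ => Set.indicator (Set.Icc b₁ b₂) abs |t| :=
    (measurable_norm.indicator measurableSet_Icc).comp measurable_norm
  have i5 : Integrable (fun x => Set.indicator (Set.Icc b₁ b₂) abs |h x|) μ := by
    refine ih.abs.mono (mI.comp hh).aestronglyMeasurable (.of_forall fun x => ?_)
    rw [Real.norm_eq_abs, Real.norm_eq_abs]
    by_cases hx : |h x| ∈ Set.Icc b₁ b₂
    · simp [Set.indicator_of_mem hx]
    · simp [Set.indicator_of_notMem hx]
  have j1 : Integrable (fun x => (a - Astar) * (F x * h x) -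
      (a - Astar) * ((1 - slab Cstar (h x)) * |h x|)) μ := (i3.const_mul _).sub (i1.const_mul _)
  have key := integral_mono (j1.sub (i5.const_mul |a - Astar|)) (integrable_loss hh hlaw hF hFv)
    fun x => linear_le_loss (hFv x) (h x) ha0
  simp only [Pi.sub_apply] at key
  rw [integral_sub j1 (i5.const_mul _),
    integral_sub (i3.const_mul _) (i1.const_mul _), integral_const_mul, integral_const_mul,
    integral_const_mul, ha, integral_comp_of_map_eq hh hlaw
      (g := fun t => (1 - slab Cstar t) * |t|)
      ((measurable_const.sub (measurable_slab _)).mul measurable_norm),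
    integral_abs_off_slab hc.le, integral_comp_of_map_eq hh hlaw mI] at key
  change (a - Astar) * a - (a - Astar) * Astar - _ ≤ _ at key
  have hI := integral_indicator_abs_le (g := abs) continuous_abs (fun t => abs_nonneg t) hb
  have hI2 : ∫ t in b₁..b₂, |t| = (b₂ ^ 2 - b₁ ^ 2) / 2 := by
    rw [intervalIntegral.integral_congr (g := fun t => t) fun t ht => ?_, integral_id]
    rw [Set.uIcc_of_le hb] at ht
    exact abs_of_nonneg (hb0.le.trans ht.1)
  have hsq : b₂ ^ 2 - b₁ ^ 2 = |(lamStar / a) ^ 2 - Cstar ^ 2| := by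
    have hba : 0 < lamStar / a := by positivity
    rcases le_total Cstar (lamStar / a) with hle | hle
    · rw [hb₁, hb₂, max_eq_right hle, min_eq_left hle, abs_of_nonneg]
      nlinarith
    · rw [hb₁, hb₂, max_eq_left hle, min_eq_right hle, abs_of_nonpos]
      · ring
      · nlinarith
  have hsq2 : (lamStar / a) ^ 2 - Cstar ^ 2 =
      -(Cstar ^ 2 * (Astar + a) / a ^ 2) * (a - Astar) := by
    rw [lamStar_eq]
    field_simp
    ring
  -- The coefficient decreases in `a`; keeping it below 0.5 is what the hypothesis `0.4 ≤ a` is for.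
  have hcoef : Cstar ^ 2 * (Astar + a) / a ^ 2 ≤ 0.5 := by
    rw [div_le_iff₀ (by positivity)]
    have : Cstar ^ 2 ≤ 0.256 ^ 2 := pow_le_pow_left₀ hc.le hc'.le 2
    have h2 : Cstar ^ 2 * (Astar + a) ≤ 0.256 ^ 2 * (0.78 + a) :=
      mul_le_mul this (by linarith) (by linarith) (by norm_num)
    nlinarith
  rw [hI2, hsq, hsq2, abs_mul, abs_neg, abs_of_nonneg (by positivity)] at hI
  have h3 : Cstar ^ 2 * (Astar + a) / a ^ 2 * |a - Astar| ≤ 0.5 * |a - Astar| :=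
    mul_le_mul_of_nonneg_right hcoef (abs_nonneg _)
  have h4 : ∫ t, Set.indicator (Set.Icc b₁ b₂) abs |t| ∂γ₁ ≤ 0.2 * |a - Astar| := by
    norm_num at h3 ⊢
    linarith
  have h5 := mul_le_mul_of_nonneg_left h4 (abs_nonneg (a - Astar))
  have h6 : |a - Astar| * (0.2 * |a - Astar|) = 0.2 * (a - Astar) ^ 2 := by
    rw [← sq_abs (a - Astar)]
    ring
  nlinarith

/-- Completing the square gives a F h - λ F² ≤ a² h²/(4λ). After integration the value is at most λ
+ a²(1/(2λ) - 1), which is too small to be nearly optimal. -/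
theorem value_le_of_small (hh : Measurable h) (hlaw : μ.map h = γ₁) (hF : Measurable F)
    (hFv : ∀ x, F x = -1 ∨ F x = 0 ∨ F x = 1) {a : ℝ} (ha : ∫ x, F x * h x ∂μ = a)
    (ha0 : 0 ≤ a) (ha' : a < 0.4) :
    a ^ 2 + lamStar - 2 * lamStar * ∫ x, F x ^ 2 ∂μ ≤ 0.456 := by
  have hl := lamStar_lower
  have hl' := lamStar_upper
  have hl0 : 0 < lamStar := by linarith
  have ih : Integrable h μ := (memLp_of_map_eq hh hlaw).integrable (by norm_num)
  have i2 : Integrable (fun x => h x ^ 2) μ := (memLp_of_map_eq hh hlaw).integrable_sq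
  have i3 : Integrable (fun x => F x * h x) μ :=
    integrable_bounded_mul hF (fun x => abs_le_one_of_mem (hFv x)) ih
  have i4 := integrable_sq_of_mem (μ := μ) hF hFv
  have key := integral_mono ((i3.const_mul a).sub (i4.const_mul lamStar))
    (i2.const_mul (a ^ 2 / (4 * lamStar))) fun x => by
      have : 0 ≤ (2 * lamStar * F x - a * h x) ^ 2 / (4 * lamStar) := by positivity
      have e : (2 * lamStar * F x - a * h x) ^ 2 / (4 * lamStar) =
          lamStar * F x ^ 2 - a * (F x * h x) + a ^ 2 / (4 * lamStar) * h x ^ 2 := by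
        field_simp
        ring
      rw [e] at this
      simp only [Pi.sub_apply]
      linarith
  simp only [Pi.sub_apply] at key
  rw [integral_sub (i3.const_mul _) (i4.const_mul _), integral_const_mul, integral_const_mul,
    integral_const_mul, ha, integral_sq_of_map_eq hh hlaw, mul_one] at key
  have h1 : a ^ 2 / (4 * lamStar) ≤ a ^ 2 / (4 * 0.1925) := by gcongr
  norm_num at h1 ha' hl hl' ⊢
  nlinarith

/-- A near-optimal function is close to `optSign`, in a weighted sense. -/
theorem integral_dist_mul_le (hh : Measurable h) (hlaw : μ.map h = γ₁) (hF : Measurable F)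
    (hFv : ∀ x, F x = -1 ∨ F x = 0 ∨ F x = 1) {δ : ℝ} (hδ : δ < 0.02)
    (ha0 : 0 ≤ ∫ x, F x * h x ∂μ)
    (hv : Astar ^ 2 * (1 - lamStar) - δ <
      (∫ x, F x * h x ∂μ) ^ 2 + lamStar - 2 * lamStar * ∫ x, F x ^ 2 ∂μ) :
    ∫ x, |F x - optSign (h x)| * |Astar * |h x| - lamStar| ∂μ ≤ 4 / 3 * δ := by
  have ih : Integrable h μ := (memLp_of_map_eq hh hlaw).integrable (by norm_num)
  -- Since 0.476 - 0.02 = 0.456, a near-optimal pair cannot fall under `value_le_of_small`, so `0.4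
  -- ≤ a`.
  have hopt : 0.476 ≤ Astar ^ 2 * (1 - lamStar) := by
    nlinarith [Astar_sq_lower, lamStar_upper, lamStar_lower]
  have ha : 0.4 ≤ ∫ x, F x * h x ∂μ := by
    by_contra! hlt
    have := value_le_of_small hh hlaw hF hFv rfl ha0 hlt
    norm_num at hopt hδ this
    linarith
  -- The deficit is 2 E[loss] - (a - A)², and (a - A)² ≤ 1.25 E[loss]. Hence 0.75 E[loss] is at most
  -- δ, which gives the factor 4/3.
  have h1 := sq_sub_le_integral_loss hh hlaw hF hFv rfl ha
  have h2 := integral_loss hh hlaw hF hFv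
  have h3 : ∫ x, |F x - optSign (h x)| * |Astar * |h x| - lamStar| ∂μ ≤
      ∫ x, loss (F x) (h x) ∂μ := by
    refine integral_mono (integrable_bounded_mul (C := 2) ?_ (fun x => ?_) ?_)
      (integrable_loss hh hlaw hF hFv) fun x => dist_mul_le_loss (hFv x) (h x)
    · exact (hF.sub (measurable_optSign.comp hh)).norm
    · rw [abs_abs]
      exact dist_optSign_le (hFv x) (h x)
    · exact ((ih.abs.const_mul _).sub (integrable_const _)).abs
  norm_num at h1
  nlinarith

/-- The weight A||t| - C| degenerates only at |t| = C. On the band of half-width √δ around C the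
distance is bounded by 2, costing 3.2√δ; elsewhere dividing by the weight costs at most 1.74√δ. -/
theorem integral_dist_le (hh : Measurable h) (hlaw : μ.map h = γ₁) (hF : Measurable F)
    (hFv : ∀ x, F x = -1 ∨ F x = 0 ∨ F x = 1) {δ : ℝ} (hδ0 : 0 < δ) (hδ : δ < 0.02)
    (ha0 : 0 ≤ ∫ x, F x * h x ∂μ)
    (hv : Astar ^ 2 * (1 - lamStar) - δ <
      (∫ x, F x * h x ∂μ) ^ 2 + lamStar - 2 * lamStar * ∫ x, F x ^ 2 ∂μ) :
    ∫ x, |F x - optSign (h x)| ∂μ ≤ 5 * √δ := by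
  have ih : Integrable h μ := (memLp_of_map_eq hh hlaw).integrable (by norm_num)
  have hA := Astar_lower
  have hA0 := Astar_pos
  have h1 := integral_dist_mul_le hh hlaw hF hFv hδ ha0 hv
  have hw : 0 < √δ := Real.sqrt_pos.2 hδ0
  have hws : √δ * √δ = δ := Real.mul_self_sqrt hδ0.le
  set w := √δ
  have mI : Measurable fun t : ℝ => Set.indicator (Set.Icc (Cstar - w) (Cstar + w))
      (fun _ => (1 : ℝ)) |t| :=
    (measurable_const.indicator measurableSet_Icc).comp measurable_norm
  have i1 : Integrable (fun x => Set.indicator (Set.Icc (Cstar - w) (Cstar + w))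
      (fun _ => (1 : ℝ)) |h x|) μ := by
    refine Integrable.of_bound (mI.comp hh).aestronglyMeasurable 1 (.of_forall fun x => ?_)
    exact (norm_indicator_le_norm_self _ _).trans (by simp)
  have md : Measurable fun x => |F x - optSign (h x)| :=
    (hF.sub (measurable_optSign.comp hh)).norm
  have i2 : Integrable (fun x => |F x - optSign (h x)| * |Astar * |h x| - lamStar|) μ := by
    refine integrable_bounded_mul (C := 2) md (fun x => ?_)
      ((ih.abs.const_mul _).sub (integrable_const _)).abs
    rw [abs_abs]
    exact dist_optSign_le (hFv x) (h x)
  have id' : Integrable (fun x => |F x - optSign (h x)|) μ := by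
    refine Integrable.of_bound md.aestronglyMeasurable 2 (.of_forall fun x => ?_)
    rw [Real.norm_eq_abs, abs_abs]
    exact dist_optSign_le (hFv x) (h x)
  have key := integral_mono id' ((i1.const_mul 2).add (i2.const_mul (Astar * w)⁻¹)) fun x => by
    have hd2 := dist_optSign_le (hFv x) (h x)
    have hd0 := abs_nonneg (F x - optSign (h x))
    simp only [Pi.add_apply]
    by_cases hx : |h x| ∈ Set.Icc (Cstar - w) (Cstar + w)
    · rw [Set.indicator_of_mem hx]
      have : 0 ≤ (Astar * w)⁻¹ * (|F x - optSign (h x)| * |Astar * |h x| - lamStar|) := by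
        positivity
      linarith
    · rw [Set.indicator_of_notMem hx, mul_zero, zero_add, inv_mul_eq_div,
        le_div_iff₀ (by positivity)]
      refine mul_le_mul_of_nonneg_left ?_ hd0
      rw [lamStar_eq, mul_comm Cstar, ← mul_sub, abs_mul, abs_of_pos hA0]
      refine mul_le_mul_of_nonneg_left ?_ hA0.le
      by_contra! hlt
      rw [abs_lt] at hlt
      exact hx ⟨by linarith, by linarith⟩
  simp only [Pi.add_apply] at key
  have hI := integral_indicator_abs_le (g := fun _ => (1 : ℝ)) continuous_const
    (fun t => zero_le_one) (show Cstar - w ≤ Cstar + w by linarith)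
  rw [intervalIntegral.integral_const, smul_eq_mul, mul_one] at hI
  rw [integral_add (i1.const_mul _) (i2.const_mul _), integral_const_mul, integral_const_mul,
    integral_comp_of_map_eq hh hlaw mI] at key
  have h2 : (Astar * w)⁻¹ * ∫ x, |F x - optSign (h x)| * |Astar * |h x| - lamStar| ∂μ ≤
      1.74 * w := by
    rw [inv_mul_le_iff₀ (by positivity)]
    refine h1.trans ?_
    rw [← hws]
    norm_num at hA ⊢
    nlinarith [mul_pos hw hw]
  linarith

end Stability

/-! ### Orthogonal projections and the direction of the linear part -/

section Projection

variable {E : Type*} [NormedAddCommGroup E] [InnerProductSpace ℝ E] (K : Submodule ℝ E)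
  [K.HasOrthogonalProjection]

theorem inner_starProjection_self (v : E) :
    inner ℝ (K.starProjection v) v = ‖K.starProjection v‖ ^ 2 := by
  rw [← real_inner_self_eq_norm_sq, ← Submodule.inner_starProjection_left_eq_right,
    Submodule.starProjection_eq_self_iff.2 (K.starProjection_apply_mem v)]

/-- Self-adjointness cancels the cross terms. With v = F and w = D this separates the two halves of
a pair. -/
theorem inner_starProjection_add_sub (v w : E) :
    inner ℝ (K.starProjection (v + w)) (v - w) =
      ‖K.starProjection v‖ ^ 2 - ‖K.starProjection w‖ ^ 2 := by
  rw [map_add, inner_add_left, inner_sub_right, inner_sub_right, inner_starProjection_self,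
    inner_starProjection_self, Submodule.inner_starProjection_left_eq_right K w v,
    real_inner_comm _ w]
  ring

theorem abs_inner_le_norm_mul_starProjection {q : E} (hq : q ∈ K) (v : E) :
    |inner ℝ q v| ≤ ‖q‖ * ‖K.starProjection v‖ := by
  rw [← Submodule.starProjection_eq_self_iff.2 hq,
    Submodule.inner_starProjection_left_eq_right, Submodule.starProjection_eq_self_iff.2 hq]
  exact abs_real_inner_le_norm _ _

end Projection

theorem sq_integral_mul_le {Ω : Type*} [MeasurableSpace Ω] {μ : Measure Ω} {v w : Ω → ℝ}
    (hv : MemLp v 2 μ) (hw : MemLp w 2 μ) :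
    (∫ x, v x * w x ∂μ) ^ 2 ≤ (∫ x, v x ^ 2 ∂μ) * ∫ x, w x ^ 2 ∂μ := by
  have key : ∀ {p q : Ω → ℝ} (hp : MemLp p 2 μ) (hq : MemLp q 2 μ),
      inner ℝ (hp.toLp p) (hq.toLp q) = ∫ x, p x * q x ∂μ := fun hp hq => by
    rw [L2.inner_def]
    refine integral_congr_ae ?_
    filter_upwards [hp.coeFn_toLp, hq.coeFn_toLp] with x h1 h2
    simp [h1, h2, mul_comm]
  have h := real_inner_mul_inner_self_le (hv.toLp v) (hw.toLp w)
  rw [key, key, key] at h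
  simpa only [sq] using h

theorem norm_sq_eq_integral_of_ae_eq {P : Lp ℝ 2 (γ n)} {p : (𝔼 n) → ℝ} (hP : P =ᵐ[γ n] p) :
    ‖P‖ ^ 2 = ∫ x, p x ^ 2 ∂(γ n) := by
  rw [← real_inner_self_eq_norm_sq, inner_eq_integral_of_ae_eq hP hP]
  simp only [sq]

theorem measurable_inner_left (u : 𝔼 n) : Measurable fun x : 𝔼 n => inner ℝ u x := by fun_prop

/-- The linear part of `F` is attained in some direction. -/
theorem exists_direction (j : Fin n) {F : (𝔼 n) → ℝ} (hF : MemLp F 2 (γ n)) :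
    ∃ u : 𝔼 n, ‖u‖ = 1 ∧ ∫ x, F x * inner ℝ u x ∂(γ n) = ‖hermiteProj n 1 (hF.toLp F)‖ := by
  set P := hermiteProj n 1 (hF.toLp F) with hP
  have hPF : inner ℝ P (hF.toLp F) = ‖P‖ ^ 2 := inner_starProjection_self _ _
  obtain ⟨v, hv⟩ : ∃ v : 𝔼 n, P =ᵐ[γ n] fun x => inner ℝ v x :=
    exists_ae_eq_inner (Submodule.starProjection_apply_mem (hermiteSpace n 1) _)
  rw [inner_eq_integral_of_ae_eq hv hF.coeFn_toLp] at hPF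
  by_cases h0 : v = 0
  · obtain ⟨Q, hQ, hQ'⟩ := exists_coord j
    have hP0 : ‖P‖ = 0 := by
      have := norm_sq_eq_integral_of_ae_eq hv
      simpa [h0] using this
    have h1 := abs_inner_le_norm_mul_starProjection _ hQ (hF.toLp F)
    rw [← hermiteProj, ← hP, hP0, mul_zero, inner_eq_integral_of_ae_eq hQ' hF.coeFn_toLp,
      abs_nonpos_iff] at h1
    refine ⟨EuclideanSpace.single j 1, by simp, ?_⟩
    rw [hP0, ← h1]
    refine integral_congr_ae (.of_forall fun x => ?_)
    simp [mul_comm, EuclideanSpace.inner_single_left]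
  · have hv0 : ‖v‖ ≠ 0 := norm_ne_zero_iff.2 h0
    have hu : ‖(‖v‖⁻¹ • v : 𝔼 n)‖ = 1 := norm_smul_inv_norm (𝕜 := ℝ) h0
    have hvu : ∀ x, inner ℝ v x = ‖v‖ * inner ℝ (‖v‖⁻¹ • v : 𝔼 n) x := fun x => by
      rw [real_inner_smul_left]
      field_simp
    have hPv : ‖P‖ = ‖v‖ := by
      have := norm_sq_eq_integral_of_ae_eq hv
      simp only [hvu, mul_pow] at this
      rw [integral_const_mul, integral_sq_of_map_eq (measurable_inner_left _) (map_inner_γ hu),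
        mul_one] at this
      exact (pow_left_inj₀ (norm_nonneg _) (norm_nonneg _) two_ne_zero).1 this
    refine ⟨_, hu, ?_⟩
    simp only [hvu, mul_assoc] at hPF
    rw [integral_const_mul, hPv, sq] at hPF
    rw [hPv]
    refine Eq.trans ?_ (mul_left_cancel₀ hv0 hPF)
    simp only [mul_comm]

/-! ### Pairs of sign functions -/

section Pair

variable {f g : (𝔼 n) → ℝ}

theorem half_sum_mem (hf : IsSign f) (hg : IsSign g) (x : 𝔼 n) :
    (f x + g x) / 2 = -1 ∨ (f x + g x) / 2 = 0 ∨ (f x + g x) / 2 = 1 := by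
  rcases hf.2 x with h1 | h1 <;> rcases hg.2 x with h2 | h2 <;> rw [h1, h2] <;> norm_num

theorem memLp_half_sum (hf : IsSign f) (hg : IsSign g) :
    MemLp (fun x => (f x + g x) / 2) 2 (γ n) := by
  simpa only [div_eq_mul_inv, Pi.add_apply, Pi.sub_apply] using ((hf.memLp _).add (hg.memLp _)).mul_const 2⁻¹

theorem memLp_half_diff (hf : IsSign f) (hg : IsSign g) :
    MemLp (fun x => (f x - g x) / 2) 2 (γ n) := by
  simpa only [div_eq_mul_inv, Pi.add_apply, Pi.sub_apply] using ((hf.memLp _).sub (hg.memLp _)).mul_const 2⁻¹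

/-- The half sum of two sign functions in `L²(γ)`. -/
def halfSum (hf : IsSign f) (hg : IsSign g) : Lp ℝ 2 (γ n) := (memLp_half_sum hf hg).toLp _

/-- The half difference of two sign functions in `L²(γ)`. -/
def halfDiff (hf : IsSign f) (hg : IsSign g) : Lp ℝ 2 (γ n) := (memLp_half_diff hf hg).toLp _

theorem coeFn_halfSum (hf : IsSign f) (hg : IsSign g) :
    halfSum hf hg =ᵐ[γ n] fun x => (f x + g x) / 2 := (memLp_half_sum hf hg).coeFn_toLp

theorem coeFn_halfDiff (hf : IsSign f) (hg : IsSign g) :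
    halfDiff hf hg =ᵐ[γ n] fun x => (f x - g x) / 2 := (memLp_half_diff hf hg).coeFn_toLp

theorem toLp_left_eq (hf : IsSign f) (hg : IsSign g) :
    (hf.memLp (γ n)).toLp f = halfSum hf hg + halfDiff hf hg := by
  rw [halfSum, halfDiff, ← MemLp.toLp_add]
  congr 1
  ext x
  simp only [Pi.add_apply]
  ring

theorem toLp_right_eq (hf : IsSign f) (hg : IsSign g) :
    (hg.memLp (γ n)).toLp g = halfSum hf hg - halfDiff hf hg := by
  rw [halfSum, halfDiff, ← MemLp.toLp_sub]
  congr 1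
  ext x
  simp only [Pi.sub_apply]
  ring

theorem inner_hermiteProj_pair (hf : IsSign f) (hg : IsSign g) (k : ℕ) :
    inner ℝ (hermiteProj n k ((hf.memLp (γ n)).toLp f)) ((hg.memLp (γ n)).toLp g) =
      ‖hermiteProj n k (halfSum hf hg)‖ ^ 2 - ‖hermiteProj n k (halfDiff hf hg)‖ ^ 2 := by
  rw [toLp_left_eq hf hg, toLp_right_eq hf hg]
  exact inner_starProjection_add_sub _ _ _

theorem inner_pair (hf : IsSign f) (hg : IsSign g) :
    inner ℝ ((hf.memLp (γ n)).toLp f) ((hg.memLp (γ n)).toLp g) =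
      2 * ∫ x, ((f x + g x) / 2) ^ 2 ∂(γ n) - 1 := by
  have h2 := (memLp_half_sum hf hg (n := n)).integrable_sq
  rw [inner_eq_integral_of_ae_eq (hf.memLp _).coeFn_toLp (hg.memLp _).coeFn_toLp,
    ← integral_const_mul]
  have h1 : ∫ _ : 𝔼 n, (1 : ℝ) ∂(γ n) = 1 := by simp
  conv_rhs => rw [← h1]
  rw [← integral_sub (h2.const_mul 2) (integrable_const _)]
  refine integral_congr_ae (.of_forall fun x => ?_)
  dsimp only
  rcases hf.2 x with h1 | h1 <;> rcases hg.2 x with h2 | h2 <;> rw [h1, h2] <;> norm_num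

theorem valAt_gameDR (hf : IsSign f) (hg : IsSign g) :
    valAt (gameDR n) ((hf.memLp (γ n)).toLp f) ((hg.memLp (γ n)).toLp g) =
      ‖hermiteProj n 1 (halfSum hf hg)‖ ^ 2 - ‖hermiteProj n 1 (halfDiff hf hg)‖ ^ 2 +
        lamStar - 2 * lamStar * ∫ x, ((f x + g x) / 2) ^ 2 ∂(γ n) := by
  rw [valAt_eq_inner, gameDR, sub_apply, inner_sub_left,
    inner_hermiteProj_pair hf hg, smul_apply, ContinuousLinearMap.id_apply,
    real_inner_smul_left, inner_pair hf hg]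
  ring

theorem valAt_gameA (ε : ℝ) (F G : Lp ℝ 2 (γ n)) :
    valAt (gameA n ε) F G = valAt (gameDR n) F G - ε * inner ℝ (hermiteProj n 3 F) G := by
  rw [valAt_eq_inner, valAt_eq_inner, gameA, perturbedGame, gameDR, sub_apply,
    inner_sub_left, show (ε • hermiteProj n 3) F = ε • hermiteProj n 3 F from rfl,
    real_inner_smul_left]

theorem abs_inner_hermiteProj_le_one (hf : IsSign f) (hg : IsSign g) (k : ℕ) :
    |inner ℝ (hermiteProj n k ((hf.memLp (γ n)).toLp f)) ((hg.memLp (γ n)).toLp g)| ≤ 1 := by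
  have hn : ∀ {p : (𝔼 n) → ℝ} (hp : IsSign p), ‖(hp.memLp (γ n)).toLp p‖ = 1 := fun {p} hp => by
    have h := norm_sq_eq_integral_of_ae_eq (hp.memLp (γ n)).coeFn_toLp
    have e : ∀ x, p x ^ 2 = 1 := fun x => by rcases hp.2 x with h | h <;> rw [h] <;> norm_num
    simp only [e] at h
    simp only [integral_const, probReal_univ, smul_eq_mul, mul_one] at h
    exact (pow_eq_one_iff_of_nonneg (norm_nonneg _) two_ne_zero).1 h
  refine (abs_real_inner_le_norm _ _).trans ?_
  rw [hn hg, mul_one, ← hn hf]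
  exact Submodule.norm_starProjection_apply_le _ _

end Pair

variable {f g : (𝔼 n) → ℝ}

/-! ### The degree-three part of a near-optimal pair -/

theorem hermite_three_mul_optSign (t : ℝ) :
    (t ^ 3 - 3 * t) * optSign t = (1 - slab Cstar t) * (|t| ^ 3 - 3 * |t|) := by
  rw [optSign, slab]
  rcases le_or_gt |t| Cstar with h | h
  · simp [h]
  · rw [if_neg h.not_ge, if_neg h.not_ge]
    rcases le_or_gt t 0 with h0 | h0
    · rw [if_neg h0.not_gt, abs_of_nonpos h0]
      ring
    · rw [if_pos h0, abs_of_pos h0]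
      ring

theorem mul_optSign (t : ℝ) : t * optSign t = (1 - slab Cstar t) * |t| := by
  rw [optSign, slab]
  rcases le_or_gt |t| Cstar with h | h
  · simp [h]
  · rw [if_neg h.not_ge, if_neg h.not_ge]
    rcases le_or_gt t 0 with h0 | h0
    · rw [if_neg h0.not_gt, abs_of_nonpos h0]
      ring
    · rw [if_pos h0, abs_of_pos h0]
      ring

theorem memLp_of_bounded {Ω : Type*} [MeasurableSpace Ω] {μ : Measure Ω} [IsFiniteMeasure μ]
    {k : Ω → ℝ} (hk : Measurable k) (C : ℝ) (hb : ∀ x, |k x| ≤ C) : MemLp k 2 μ :=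
  MemLp.of_bound hk.aestronglyMeasurable C (.of_forall hb)

theorem integrable_mul_of_memLp {Ω : Type*} [MeasurableSpace Ω] {μ : Measure Ω} {v w : Ω → ℝ}
    (hv : MemLp v 2 μ) (hw : MemLp w 2 μ) : Integrable (fun x => v x * w x) μ :=
  hv.integrable_mul hw

theorem norm_hermiteProj_halfSum_ge (j : Fin n) (hf : IsSign f) (hg : IsSign g) {u : 𝔼 n}
    (hu : ‖u‖ = 1) {z : ℝ} (hz : 0 ≤ z)
    (hd : ∫ x, |(f x + g x) / 2 - optSign (inner ℝ u x)| ∂(γ n) ≤ 5 * z ^ 2) :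
    Astar * (1 - Cstar ^ 2) - 7.75 * z ≤ √6 * ‖hermiteProj n 3 (halfSum hf hg)‖ := by
  set h : (𝔼 n) → ℝ := fun x => inner ℝ u x with hh_def
  have hh : Measurable h := measurable_inner_left u
  have hlaw : (γ n).map h = γ₁ := map_inner_γ hu
  set F : (𝔼 n) → ℝ := fun x => (f x + g x) / 2 with hF_def
  have hF : Measurable F := (hf.1.add hg.1).div_const 2
  have hFv : ∀ x, F x = -1 ∨ F x = 0 ∨ F x = 1 := half_sum_mem hf hg
  have hF2 : MemLp F 2 (γ n) := memLp_half_sum hf hg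
  obtain ⟨Q, hQ, hQ'⟩ := exists_hermite_three_inner j hu
  have hQn : ‖Q‖ = √6 := by
    rw [eq_comm, Real.sqrt_eq_iff_mul_self_eq (by norm_num) (norm_nonneg _), ← sq,
      norm_sq_eq_integral_of_ae_eq hQ']
    exact (integral_hermite_three_sq_of_map_eq hh hlaw).symm
  have h1 := abs_inner_le_norm_mul_starProjection _ hQ (halfSum hf hg)
  rw [hQn, inner_eq_integral_of_ae_eq hQ' (coeFn_halfSum hf hg)] at h1
  refine le_trans ?_ h1
  have mq : MemLp (fun x => h x ^ 3 - 3 * h x) 2 (γ n) := by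
    have := memLp_eval_of_map_eq hh hlaw (hermiteReal 3)
    simpa only [hermiteReal_three_eval] using this
  have ms : Measurable fun x => optSign (h x) := measurable_optSign.comp hh
  have m1 : MemLp (fun x => optSign (h x)) 2 (γ n) :=
    memLp_of_bounded ms 1 fun x => abs_le_one_of_mem (optSign_mem _)
  have m2 : MemLp (fun x => F x - optSign (h x)) 2 (γ n) := hF2.sub m1
  have e1 : ∫ x, (h x ^ 3 - 3 * h x) * F x ∂(γ n) =
      ∫ x, (h x ^ 3 - 3 * h x) * optSign (h x) ∂(γ n) +
        ∫ x, (h x ^ 3 - 3 * h x) * (F x - optSign (h x)) ∂(γ n) := by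
    rw [← integral_add (integrable_mul_of_memLp mq m1) (integrable_mul_of_memLp mq m2)]
    refine integral_congr_ae (.of_forall fun x => ?_)
    ring
  have e2 : ∫ x, (h x ^ 3 - 3 * h x) * optSign (h x) ∂(γ n) = -(Astar * (1 - Cstar ^ 2)) := by
    rw [integral_comp_of_map_eq hh hlaw (g := fun t => (t ^ 3 - 3 * t) * optSign t)
      (Measurable.mul (by fun_prop) measurable_optSign)]
    simp only [hermite_three_mul_optSign]
    rw [integral_hermite_three_off_slab Cstar_mem.1.le, Astar]
    ring
  have e3 := sq_integral_mul_le mq m2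
  rw [integral_hermite_three_sq_of_map_eq hh hlaw] at e3
  have e4 : ∫ x, (F x - optSign (h x)) ^ 2 ∂(γ n) ≤ 2 * (5 * z ^ 2) := by
    refine le_trans ?_ (mul_le_mul_of_nonneg_left hd zero_le_two)
    rw [← integral_const_mul]
    refine integral_mono m2.integrable_sq ((m2.integrable (by norm_num)).abs.const_mul 2)
      fun x => ?_
    have h2 := dist_optSign_le (hFv x) (h x)
    have h3 := abs_nonneg (F x - optSign (h x))
    dsimp only
    rw [← sq_abs]
    nlinarith
  have e5 : |∫ x, (h x ^ 3 - 3 * h x) * (F x - optSign (h x)) ∂(γ n)| ≤ 7.75 * z := by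
    refine abs_le_of_sq_le_sq ?_ (by positivity)
    norm_num
    nlinarith
  rw [e1, e2]
  have e6 := abs_le.1 e5
  refine le_trans ?_ (neg_le_abs _)
  linarith [e6.2]

theorem norm_hermiteProj_halfDiff_le (j : Fin n) (hf : IsSign f) (hg : IsSign g) {u : 𝔼 n}
    (hu : ‖u‖ = 1) {z : ℝ} (hz : 0 ≤ z)
    (hd : ∫ x, |(f x + g x) / 2 - optSign (inner ℝ u x)| ∂(γ n) ≤ 5 * z ^ 2) :
    ‖hermiteProj n 3 (halfDiff hf hg)‖ ≤ (1 - Astar ^ 2) / 2 + 2.25 * z := by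
  set h : (𝔼 n) → ℝ := fun x => inner ℝ u x with hh_def
  have hh : Measurable h := measurable_inner_left u
  have hlaw : (γ n).map h = γ₁ := map_inner_γ hu
  set D : (𝔼 n) → ℝ := fun x => (f x - g x) / 2 with hD_def
  have hD : Measurable D := (hf.1.sub hg.1).div_const 2
  have hDb : ∀ x, |D x| ≤ 1 := fun x => by
    simp only [hD_def]
    rcases hf.2 x with h1 | h1 <;> rcases hg.2 x with h2 | h2 <;> rw [h1, h2] <;> norm_num
  have hD2 : MemLp D 2 (γ n) := memLp_half_diff hf hg
  have hP0 : 0 ≤ (1 - Astar ^ 2) / 2 := by linarith [Astar_sq_upper]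
  set P := hermiteProj n 3 (halfDiff hf hg) with hP
  have hPK : P ∈ hermiteSpace n 3 := Submodule.starProjection_apply_mem _ _
  have hPD : inner ℝ P (halfDiff hf hg) = ‖P‖ ^ 2 := inner_starProjection_self _ _
  rw [inner_eq_integral_of_ae_eq (Filter.EventuallyEq.refl _ P) (coeFn_halfDiff hf hg)] at hPD
  have hPn : ∫ x, P x ^ 2 ∂(γ n) = ‖P‖ ^ 2 :=
    (norm_sq_eq_integral_of_ae_eq (Filter.EventuallyEq.refl _ P)).symm
  have mP : MemLp P 2 (γ n) := Lp.memLp P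
  have msl : Measurable fun x => slab Cstar (h x) := (measurable_slab _).comp hh
  have m1 : MemLp (fun x => slab Cstar (h x)) 2 (γ n) := memLp_of_bounded msl 1 fun x => by
    rw [abs_of_nonneg (slab_nonneg _ _)]
    exact slab_le_one _ _
  have hsb : ∀ x, |1 - slab Cstar (h x)| ≤ 1 := fun x => by
    rw [abs_le]
    constructor <;> linarith [slab_nonneg Cstar (h x), slab_le_one Cstar (h x)]
  have me : Measurable fun x => (1 - slab Cstar (h x)) * |D x| :=
    (measurable_const.sub msl).mul hD.norm
  have m2 : MemLp (fun x => (1 - slab Cstar (h x)) * |D x|) 2 (γ n) :=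
    memLp_of_bounded me 1 fun x => by
      rw [abs_mul, abs_abs]
      exact mul_le_one₀ (hsb x) (abs_nonneg _) (hDb x)
  have m3 : MemLp (fun x => slab Cstar (h x) * |P x|) 2 (γ n) := by
    refine MemLp.of_le mP (msl.aestronglyMeasurable.mul mP.abs.aestronglyMeasurable)
      (.of_forall fun x => ?_)
    rw [norm_mul, Real.norm_of_nonneg (slab_nonneg _ _), Real.norm_eq_abs, Real.norm_eq_abs,
      abs_abs]
    exact mul_le_of_le_one_left (abs_nonneg _) (slab_le_one _ _)
  have b1 : ∫ x, slab Cstar (h x) * (slab Cstar (h x) * |P x|) ∂(γ n) ≤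
      (1 - Astar ^ 2) / 2 * ‖P‖ := by
    have c1 := sq_integral_mul_le m1 m3
    have c2 : ∫ x, slab Cstar (h x) ^ 2 ∂(γ n) = (1 - Astar ^ 2) / 2 := by
      simp only [sq, slab_mul_self]
      rw [integral_comp_of_map_eq hh hlaw (measurable_slab _), integral_slab_Cstar, sq]
    have c3 : ∫ x, (slab Cstar (h x) * |P x|) ^ 2 ∂(γ n) ≤ (1 - Astar ^ 2) / 2 * ‖P‖ ^ 2 := by
      have := integral_slab_inner_sq_le Cstar_mem.2.le j hu hPK
      rw [integral_slab_Cstar, hPn] at this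
      refine le_of_eq_of_le (integral_congr_ae (.of_forall fun x => ?_)) this
      simp only [mul_pow, sq_abs]
      rw [sq, slab_mul_self]
    rw [c2] at c1
    refine (abs_le_of_sq_le_sq' (c1.trans ?_) (by positivity)).2
    calc _ ≤ (1 - Astar ^ 2) / 2 * ((1 - Astar ^ 2) / 2 * ‖P‖ ^ 2) :=
          mul_le_mul_of_nonneg_left c3 hP0
      _ = _ := by ring
  have b2 : ∫ x, ((1 - slab Cstar (h x)) * |D x|) * |P x| ∂(γ n) ≤ 2.25 * z * ‖P‖ := by
    have c1 := sq_integral_mul_le m2 mP.abs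
    have c2 : ∫ x, ((1 - slab Cstar (h x)) * |D x|) ^ 2 ∂(γ n) ≤ 5 * z ^ 2 := by
      refine le_trans ?_ hd
      have i1 : Integrable (fun x => |(f x + g x) / 2 - optSign (h x)|) (γ n) :=
        (((memLp_half_sum hf hg).integrable (by norm_num)).sub
          ((memLp_of_bounded (measurable_optSign.comp hh) 1 fun x =>
            abs_le_one_of_mem (optSign_mem _)).integrable (by norm_num))).abs
      refine integral_mono m2.integrable_sq i1 fun x => ?_
      simp only [hD_def, slab, optSign]
      rcases hf.2 x with h1 | h1 <;> rcases hg.2 x with h2 | h2 <;> rw [h1, h2] <;>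
        split_ifs <;> norm_num
    simp only [Pi.abs_apply, sq_abs, hPn] at c1
    refine (abs_le_of_sq_le_sq' (c1.trans ?_) (by positivity)).2
    calc _ ≤ (5 * z ^ 2) * ‖P‖ ^ 2 := mul_le_mul_of_nonneg_right c2 (sq_nonneg _)
      _ ≤ _ := by
        rw [mul_pow, mul_pow]
        refine mul_le_mul_of_nonneg_right ?_ (sq_nonneg _)
        exact mul_le_mul_of_nonneg_right (by norm_num) (sq_nonneg _)
  have b3 : ‖P‖ ^ 2 ≤ ∫ x, slab Cstar (h x) * (slab Cstar (h x) * |P x|) ∂(γ n) +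
      ∫ x, ((1 - slab Cstar (h x)) * |D x|) * |P x| ∂(γ n) := by
    have i1 := integrable_mul_of_memLp m1 m3
    have i2 := integrable_mul_of_memLp m2 mP.abs
    simp only [Pi.abs_apply] at i2
    rw [← hPD, ← integral_add i1 i2]
    refine integral_mono (integrable_mul_of_memLp mP hD2) (i1.add i2) fun x => ?_
    change P x * D x ≤ _
    rw [← mul_assoc, slab_mul_self]
    have c1 : P x * D x ≤ |P x| * |D x| := (le_abs_self _).trans (abs_mul _ _).le
    have c2 : slab Cstar (h x) * |P x| * |D x| ≤ slab Cstar (h x) * |P x| :=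
      mul_le_of_le_one_right (mul_nonneg (slab_nonneg _ _) (abs_nonneg _)) (hDb x)
    linarith
  by_contra! hlt
  have hpos : 0 < ‖P‖ := lt_of_le_of_lt (by positivity) hlt
  nlinarith

theorem degree_three_bound {X Y z : ℝ} (hz : 0 ≤ z) (hz' : 12 * z < 1.046) (hY0 : 0 ≤ Y)
    (hX : Astar * (1 - Cstar ^ 2) - 7.75 * z ≤ √6 * X)
    (hY : Y ≤ (1 - Astar ^ 2) / 2 + 2.25 * z) : 0.046 - 12 * z ≤ X ^ 2 - Y ^ 2 := by
  have hgap := degree_three_gap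
  have hA := Astar_lower
  have hA' := Astar_upper
  have hA2 := Astar_sq_lower
  set B := Astar * (1 - Cstar ^ 2) with hB
  set p := (1 - Astar ^ 2) / 2 with hp
  have hB1 : 0.7195 ≤ B := by nlinarith [Cstar_lt, lt_Cstar]
  have hB2 : B ≤ 0.78 := by nlinarith [Cstar_lt, lt_Cstar, sq_nonneg Cstar]
  have hp1 : p ≤ 0.202 := by linarith
  have hp0 : 0 ≤ p := by linarith [Astar_sq_upper]
  have h0 : 0 ≤ B - 7.75 * z := by linarith
  have h1 : (B - 7.75 * z) ^ 2 ≤ 6 * X ^ 2 := by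
    have := pow_le_pow_left₀ h0 hX 2
    rwa [mul_pow, Real.sq_sqrt (by norm_num)] at this
  have h2 := pow_le_pow_left₀ hY0 hY 2
  have hBz := mul_le_mul_of_nonneg_right hB2 hz
  have hpz := mul_le_mul_of_nonneg_right hp1 hz
  norm_num at *
  nlinarith

theorem inner_hermiteProj_three_ge (j : Fin n) (hf : IsSign f) (hg : IsSign g) {δ : ℝ}
    (hδ : 0 < δ) (hδ' : 12 * δ ^ (1 / 4 : ℝ) < 1.046)
    (hv : Astar ^ 2 * (1 - lamStar) - δ <
      valAt (gameDR n) ((hf.memLp (γ n)).toLp f) ((hg.memLp (γ n)).toLp g)) :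
    0.046 - 12 * δ ^ (1 / 4 : ℝ) ≤
      inner ℝ (hermiteProj n 3 ((hf.memLp (γ n)).toLp f)) ((hg.memLp (γ n)).toLp g) := by
  have hz : 0 ≤ δ ^ (1 / 4 : ℝ) := by positivity
  have hz2 : √δ = (δ ^ (1 / 4 : ℝ)) ^ 2 := by
    rw [Real.sqrt_eq_rpow, ← Real.rpow_natCast, ← Real.rpow_mul hδ.le]
    norm_num
  have hδz : δ = ((δ ^ (1 / 4 : ℝ)) ^ 2) ^ 2 := by rw [← hz2, Real.sq_sqrt hδ.le]
  set z := δ ^ (1 / 4 : ℝ)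
  have hz1 : z ≤ 0.1 := by
    norm_num at hδ' ⊢
    linarith
  have hδ2 : δ < 0.02 := by
    have := pow_le_pow_left₀ hz hz1 4
    rw [hδz, ← pow_mul]
    norm_num at this ⊢
    linarith
  obtain ⟨u, hu, hFu⟩ := exists_direction j (memLp_half_sum hf hg)
  have hd := integral_dist_le (measurable_inner_left u) (map_inner_γ hu)
    ((hf.1.add hg.1).div_const 2) (half_sum_mem hf hg) hδ hδ2
    (by simp only [Pi.add_apply]; rw [hFu]; exact norm_nonneg _) (by
      simp only [Pi.add_apply]
      rw [hFu]
      rw [valAt_gameDR hf hg] at hv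
      have := sq_nonneg ‖hermiteProj n 1 (halfDiff hf hg)‖
      rw [halfSum] at hv
      linarith)
  simp only [Pi.add_apply] at hd
  rw [hz2] at hd
  rw [inner_hermiteProj_pair hf hg]
  exact degree_three_bound hz hδ' (norm_nonneg _)
    (norm_hermiteProj_halfSum_ge j hf hg hu hz hd) (norm_hermiteProj_halfDiff_le j hf hg hu hz hd)

/-! ### The value of the Davie–Reeds game -/

theorem isSign_optSign_add (j : Fin n) :
    IsSign fun x : 𝔼 n => optSign (x j) + slab Cstar (x j) := by
  have hj : Measurable fun x : 𝔼 n => x j := by fun_prop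
  refine ⟨(measurable_optSign.comp hj).add ((measurable_slab _).comp hj), fun x => ?_⟩
  simp only [optSign, slab]
  split_ifs <;> norm_num

theorem isSign_optSign_sub (j : Fin n) :
    IsSign fun x : 𝔼 n => optSign (x j) - slab Cstar (x j) := by
  have hj : Measurable fun x : 𝔼 n => x j := by fun_prop
  refine ⟨(measurable_optSign.comp hj).sub ((measurable_slab _).comp hj), fun x => ?_⟩
  simp only [optSign, slab]
  split_ifs <;> norm_num

theorem le_val_gameDR (j : Fin n) : Astar ^ 2 * (1 - lamStar) ≤ val (gameDR n) := by
  have hf := isSign_optSign_add j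
  have hg := isSign_optSign_sub j
  refine le_trans ?_ (le_csSup (valSet_bddAbove _) ⟨_, _, hf, hg, rfl⟩)
  rw [valAt_gameDR hf hg]
  have hj : Measurable fun x : 𝔼 n => x j := by fun_prop
  have hu : ‖(EuclideanSpace.single j 1 : 𝔼 n)‖ = 1 := by simp
  have hlaw : (γ n).map (fun x : 𝔼 n => x j) = γ₁ := by
    simpa [EuclideanSpace.inner_single_left] using map_inner_γ hu
  have hS : halfSum hf hg =ᵐ[γ n] fun x => optSign (x j) :=
    (coeFn_halfSum hf hg).trans (.of_forall fun x => by dsimp only; ring)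
  have hD : halfDiff hf hg =ᵐ[γ n] fun x => slab Cstar (x j) :=
    (coeFn_halfDiff hf hg).trans (.of_forall fun x => by dsimp only; ring)
  have hD0 : ‖hermiteProj n 1 (halfDiff hf hg)‖ ^ 2 = 0 := by
    obtain ⟨v, hv⟩ := exists_ae_eq_inner (Submodule.starProjection_apply_mem (hermiteSpace n 1)
      (halfDiff hf hg))
    rw [hermiteProj, ← inner_starProjection_self, inner_eq_integral_of_ae_eq hv hD]
    have h := integral_comp_isometry (LinearIsometryEquiv.neg ℝ)
      fun x : 𝔼 n => inner ℝ v x * slab Cstar (x j)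
    have e : ∀ x : 𝔼 n, slab Cstar ((-x) j) = slab Cstar (x j) := fun x => by simp [slab]
    simp only [LinearIsometryEquiv.coe_neg, e, inner_neg_right, neg_mul] at h
    rw [integral_neg] at h
    linarith
  have hS1 : Astar ≤ ‖hermiteProj n 1 (halfSum hf hg)‖ := by
    obtain ⟨Q, hQ, hQ'⟩ := exists_coord j
    have hQn : ‖Q‖ = 1 := by
      have := norm_sq_eq_integral_of_ae_eq hQ'
      rw [integral_sq_of_map_eq hj hlaw] at this
      exact (pow_eq_one_iff_of_nonneg (norm_nonneg _) two_ne_zero).1 this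
    have h1 := abs_inner_le_norm_mul_starProjection _ hQ (halfSum hf hg)
    rw [hQn, one_mul, inner_eq_integral_of_ae_eq hQ' hS,
      integral_comp_of_map_eq hj hlaw (g := fun t => t * optSign t)
        (measurable_id.mul measurable_optSign)] at h1
    simp only [mul_optSign] at h1
    rw [integral_abs_off_slab Cstar_mem.1.le] at h1
    exact (le_abs_self _).trans h1
  have hS2 : ∫ x : 𝔼 n, ((optSign (x j) + slab Cstar (x j) +
      (optSign (x j) - slab Cstar (x j))) / 2) ^ 2 ∂(γ n) = (1 + Astar ^ 2) / 2 := by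
    have e : ∀ x : 𝔼 n, ((optSign (x j) + slab Cstar (x j) +
        (optSign (x j) - slab Cstar (x j))) / 2) ^ 2 = 1 - slab Cstar (x j) := fun x => by
      simp only [optSign, slab]
      split_ifs <;> norm_num
    simp only [e]
    rw [integral_sub (integrable_const _) (by
        simpa using integrable_slab_mul Cstar hj (integrable_const (1 : ℝ))),
      integral_comp_of_map_eq hj hlaw (measurable_slab _), integral_slab_Cstar]
    simp
    ring
  rw [hD0, hS2]
  nlinarith [pow_le_pow_left₀ Astar_pos.le hS1 2]

end HermiteGame

end

theorem mainTheorem2 (n : ℕ) (hn : 1 ≤ n) (ε : ℝ) (hε : 0 ≤ ε) :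
    HermiteGame.val (HermiteGame.gameA n ε) ≤
        HermiteGame.val (HermiteGame.gameDR n) - ε * (0.046 - 12 * (2 * ε) ^ (1 / 4 : ℝ)) ∧
      (0 < ε → 12 * (2 * ε) ^ (1 / 4 : ℝ) < 0.046 →
        HermiteGame.val (HermiteGame.gameA n ε) < HermiteGame.val (HermiteGame.gameDR n)) := by
  have main : HermiteGame.val (HermiteGame.gameA n ε) ≤
      HermiteGame.val (HermiteGame.gameDR n) - ε * (0.046 - 12 * (2 * ε) ^ (1 / 4 : ℝ)) := by
    refine csSup_le (HermiteGame.valSet_nonempty _) ?_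
    rintro _ ⟨f, g, hf, hg, rfl⟩
    rw [HermiteGame.valAt_gameA]
    have hv := le_csSup (HermiteGame.valSet_bddAbove (HermiteGame.gameDR n)) ⟨f, g, hf, hg, rfl⟩
    change _ ≤ HermiteGame.val _ at hv
    have hopt := HermiteGame.le_val_gameDR (⟨0, hn⟩ : Fin n)
    have hs := (abs_le.1 (HermiteGame.abs_inner_hermiteProj_le_one hf hg 3)).1
    have hz : 0 ≤ (2 * ε) ^ (1 / 4 : ℝ) := by positivity
    have key := HermiteGame.inner_hermiteProj_three_ge ⟨0, hn⟩ hf hg (δ := 2 * ε)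
    rcases hε.eq_or_lt with rfl | hε
    · simpa using hv
    rcases le_or_gt 1.046 (12 * (2 * ε) ^ (1 / 4 : ℝ)) with hbig | hsmall
    · have h1 := mul_le_mul_of_nonneg_left hbig hε.le
      have h2 := mul_le_mul_of_nonneg_left hs hε.le
      linarith
    rcases lt_or_ge (HermiteGame.Astar ^ 2 * (1 - HermiteGame.lamStar) - 2 * ε)
      (HermiteGame.valAt (HermiteGame.gameDR n) ((hf.memLp _).toLp f) ((hg.memLp _).toLp g))
      with hnear | hfar
    · have h1 := mul_le_mul_of_nonneg_left (key (by linarith) hsmall hnear) hε.le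
      linarith
    · have h1 := mul_nonneg hε.le hz
      have h2 := mul_le_mul_of_nonneg_left hs hε.le
      linarith
  refine ⟨main, fun h0 h1 => main.trans_lt ?_⟩
  have := mul_pos h0 (sub_pos.2 h1)
  linarith
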